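/- **Lemma (end types).** Let $k\ge 1$ be an integer, $\lambda>1$ and $c\neq 0$ real. Let $\overline M$ be the compact Riemann surface $$\overline M=\Big\{(z,w)\in(\mathbb C\cup\{\infty\})^2 : w^{k+1}=z\Big(\frac{z-\lambda^{-1}}{\lambda-z}\Big)^k\Big\},$$ let $M=\overline M\setminus\{(0,0),(\infty,\infty)\}$, with universal cover $\pi:\widetilde M\to M$, and let $G=\lambda^{k/(k+1)}w$, $\Omega=c\,\frac{dz}{zw}$. By a CMC 1 face with data $(k,\lambda,c)$ we mean a map $f:M\to S^3_1=\{ae_3a^*: a\in \mathrm{SL}(2,\mathbb C)\}$, $e_3=\mathrm{diag}(1,-1)$, such that $f\circ\pi=Fe_3F^*$ for a holomorphic solution $F:\widetilde M\to \mathrm{SL}(2,\mathbb C)$ of $$dF\cdot F^{-1}=\begin{pmatrix}G&-G^2\\1&-G\end{pmatrix}\Omega .$$ Continuation of $F$ along a small simple circle around one of the two punctures (ends) $(0,0)$, $(\infty,\infty)$ turns $F$ into $F\rho$ with $\rho\in \mathrm{SU}(1,1)$. The end is called elliptic if $\rho$ is conjugate in $\mathrm{SU}(1,1)$ to $\mathrm{diag}(e^{i\theta},e^{-i\theta})$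 for some real $\theta$, and hyperbolic if $\rho$ is conjugate in $\mathrm{SU}(1,1)$ to $\pm\begin{pmatrix}\cosh s&\sinh s\\ \sinh s&\cosh s\end{pmatrix}$ for some $s>0$. Put $\Delta=1-4c(k+1)\lambda^{k/(k+1)}$. (1) For every CMC 1 face with data $(k,\lambda,c)$: if $\Delta>0$ and $\sqrt\Delta$ is not a positive integer multiple of $k+1$, then both ends are elliptic; if $\Delta<0$, then both ends are hyperbolic. (2) Let $\lambda=2$ and, for $k=1,\dots,20$ in this order, let $c_k$ be $-0.557726$, $-0.505010$, $-0.483326$, $-0.471988$, $-0.465097$, $-0.460530$, $-0.457291$, $-0.454881$, $-0.453020$, $-0.451543$, $-0.450342$, $-0.449348$, $-0.448511$, $-0.447797$, $-0.447182$, $-0.446645$, $-0.446173$, $-0.445756$, $-0.445383$, $-0.445049$ (the middle column of the table). If $1\le k\le 20$ and $|c-c_k|\le 10^{-4}$, then $\Delta>0$, and both ends of every CMC 1 face with data $(k,2,c)$ are elliptic. (3) Let $\lambda=2$ and, for $k=1,\dots,20$ in this order, let $c_k'$ be $0.704094$, $0.548964$, $0.482090$, $0.444727$, $0.420845$, $0.404255$,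 $0.392055$, $0.382705$, $0.375309$, $0.369312$, $0.364352$, $0.360180$, $0.356623$, $0.353553$, $0.350878$, $0.348525$, $0.346439$, $0.344578$, $0.342907$, $0.341398$ (the right hand column of the table). If $1\le k\le 20$ and $|c-c_k'|\le 10^{-4}$, then $\Delta<0$, and both ends of every CMC 1 face with data $(k,2,c)$ are hyperbolic. -/

import Mathlib

open scoped Topology Matrix

universe u

noncomputable section

namespace CMCFace

/-! ### The Riemann surface and the Weierstrass data -/

/-- The compact Riemann surface `w ^ (k+1) = z * ((z - 1/lam) / (lam - z)) ^ k`, as a subset of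
`(ℂ ∪ {∞})²`. The equation has exactly two solutions with an infinite coordinate, `(lam, ∞)` and
`(∞, ∞)`. The subspace topology is the topology of the Riemann surface. -/
def closedCurve (k : ℕ) (lam : ℝ) : Set (OnePoint ℂ × OnePoint ℂ) :=
  {p | ∃ z w : ℂ, p = ((z : OnePoint ℂ), (w : OnePoint ℂ)) ∧ z ≠ (lam : ℂ) ∧
      w ^ (k + 1) = z * ((z - (lam : ℂ)⁻¹) / ((lam : ℂ) - z)) ^ k} ∪
    {(((lam : ℂ) : OnePoint ℂ), OnePoint.infty), (OnePoint.infty, OnePoint.infty)}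

/-- The surface `M`: the closed curve without the two points `(0, 0)` and `(∞, ∞)`. -/
def curve (k : ℕ) (lam : ℝ) : Set (OnePoint ℂ × OnePoint ℂ) :=
  closedCurve k lam \
    {(((0 : ℂ) : OnePoint ℂ), ((0 : ℂ) : OnePoint ℂ)), (OnePoint.infty, OnePoint.infty)}

/-- The number `lam ^ (k/(k+1))`. -/
def scale (k : ℕ) (lam : ℝ) : ℝ := lam ^ ((k : ℝ) / ((k : ℝ) + 1))

/-- The hyperbolic Gauss map `G = lam ^ (k/(k+1)) * w` at a point with finite `w`. -/
def gaussMap (k : ℕ) (lam : ℝ) (w : ℂ) : ℂ := (scale k lam : ℂ) * w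

/-- The coefficient of `dz` in `[[G, -G²], [1, -G]] Ω`, where `Ω = c dz / (z w)`. -/
def connectionMatrix (k : ℕ) (lam c : ℝ) (z w : ℂ) : Matrix (Fin 2) (Fin 2) ℂ :=
  ((c : ℂ) / (z * w)) •
    !![gaussMap k lam w, -(gaussMap k lam w) ^ 2; 1, -(gaussMap k lam w)]

/-- `F : X → SL(2, ℂ)` is a holomorphic solution of `dF · F⁻¹ = [[G, -G²], [1, -G]] Ω`, where
`π : X → M` is a covering.

`z` is a local coordinate of `M` away from `z = 1/lam` and `z = lam` (the latter being the point
with `w = ∞`). Near such a point `F` is a function `Φ` of `z`, and the equation reads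
`dΦ/dz = connectionMatrix * Φ`. The points over the two remaining values of `z` are isolated;
holomorphy and the equation in the coordinate `ζ`, `ζ ^ (k+1) = z - 1/lam` or `z - lam`, are
equivalent there to the continuity of `F`, by removal of singularities. -/
structure IsSolution (k : ℕ) (lam c : ℝ) {X : Type u} [TopologicalSpace X]
    (π : X → curve k lam) (F : X → Matrix.SpecialLinearGroup (Fin 2) ℂ) : Prop where
  continuous : Continuous F
  equation : ∀ (x : X) (z₀ w₀ : ℂ),
    (π x).1 = ((z₀ : OnePoint ℂ), (w₀ : OnePoint ℂ)) → z₀ ≠ (lam : ℂ)⁻¹ →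
    ∃ Φ : ℂ → Matrix (Fin 2) (Fin 2) ℂ,
      (∀ᶠ y in 𝓝 x, ∀ z : ℂ, (π y).1.1 = (z : OnePoint ℂ) →
        (F y : Matrix (Fin 2) (Fin 2) ℂ) = Φ z) ∧
      ∀ i j, HasDerivAt (fun z => Φ z i j) ((connectionMatrix k lam c z₀ w₀ * Φ z₀) i j) z₀

/-! ### De Sitter space and the CMC 1 faces -/

/-- The matrix `e₃ = diag(1, -1)`. -/
def e3 : Matrix (Fin 2) (Fin 2) ℂ := !![1, 0; 0, -1]

/-- The matrix `a e₃ a*`. -/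
def hermitianOrbit (a : Matrix.SpecialLinearGroup (Fin 2) ℂ) : Matrix (Fin 2) (Fin 2) ℂ :=
  (a : Matrix (Fin 2) (Fin 2) ℂ) * e3 * (a : Matrix (Fin 2) (Fin 2) ℂ)ᴴ

/-- De Sitter 3-space `S³₁ = {a e₃ a* | a ∈ SL(2, ℂ)}`. -/
def deSitter : Set (Matrix (Fin 2) (Fin 2) ℂ) := Set.range hermitianOrbit

/-- A CMC 1 face `f : M → S³₁` with the Weierstrass data of `k`, `lam`, `c`: a universal covering
`π : X → M`, a solution `F` on `X`, and a map `f` on `M` itself with `f ∘ π = F e₃ F*`. -/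
structure Face (k : ℕ) (lam c : ℝ) where
  /-- the universal cover of `M` -/
  X : Type u
  [top : TopologicalSpace X]
  [simplyConnected : SimplyConnectedSpace X]
  /-- the covering projection -/
  π : X → curve k lam
  isCovering : IsCoveringMap π
  surjective : Function.Surjective π
  /-- the holomorphic null lift -/
  F : X → Matrix.SpecialLinearGroup (Fin 2) ℂ
  isSolution : IsSolution k lam c π F
  /-- the surface -/
  f : curve k lam → deSitter
  f_eq : ∀ x, (f (π x) : Matrix (Fin 2) (Fin 2) ℂ) = hermitianOrbit (F x)

attribute [instance] Face.top Face.simplyConnected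

/-! ### Ends and their types -/

/-- `SU(1,1)`. -/
def SU11 : Set (Matrix.SpecialLinearGroup (Fin 2) ℂ) := {a | hermitianOrbit a = e3}

/-- `ρ` is conjugate in `SU(1,1)` to `diag(e^{iθ}, e^{-iθ})` for a real `θ`. -/
def IsElliptic (ρ : Matrix.SpecialLinearGroup (Fin 2) ℂ) : Prop :=
  ∃ P ∈ SU11, ∃ θ : ℝ,
    ((P⁻¹ * ρ * P : Matrix.SpecialLinearGroup (Fin 2) ℂ) : Matrix (Fin 2) (Fin 2) ℂ) =
      !![Complex.exp (θ * Complex.I), 0; 0, Complex.exp (-(θ * Complex.I))]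

/-- `ρ` is conjugate in `SU(1,1)` to `± [[cosh s, sinh s], [sinh s, cosh s]]` for an `s > 0`. -/
def IsHyperbolic (ρ : Matrix.SpecialLinearGroup (Fin 2) ℂ) : Prop :=
  ∃ P ∈ SU11, ∃ s : ℝ, 0 < s ∧ ∃ ε : ℂ, (ε = 1 ∨ ε = -1) ∧
    ((P⁻¹ * ρ * P : Matrix.SpecialLinearGroup (Fin 2) ℂ) : Matrix (Fin 2) (Fin 2) ℂ) =
      ε • !![(Real.cosh s : ℂ), (Real.sinh s : ℂ); (Real.sinh s : ℂ), (Real.cosh s : ℂ)]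

/-- The two ends of `M`: the punctures `(0, 0)` and `(∞, ∞)`. -/
inductive End
  | zero
  | infinity

/-- The function `z` in terms of the local coordinate `ζ` at an end: `z = ζ ^ (k+1)` at `(0, 0)`,
and `z = ζ ^ (-(k+1))` at `(∞, ∞)`. -/
def End.z (k : ℕ) : End → ℂ → ℂ
  | .zero, ζ => ζ ^ (k + 1)
  | .infinity, ζ => (ζ ^ (k + 1))⁻¹

namespace Face

variable {k : ℕ} {lam c : ℝ}

/-- `σ` lifts to `X` a circle that goes once around the end `e`: a positively oriented circle
`|ζ| = r` in the disc `|ζ| ^ (k+1) < 1/lam` of the local coordinate `ζ` at `e`, on which there is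
no other puncture or branch point of `z`. -/
def IsLiftedCircle (S : Face.{u} k lam c) (e : End) (σ : unitInterval → S.X) : Prop :=
  Continuous σ ∧ ∃ r : ℝ, 0 < r ∧ r ^ (k + 1) < lam⁻¹ ∧
    ∀ t : unitInterval, (S.π (σ t)).1.1 =
      ((e.z k (r * Complex.exp (2 * Real.pi * (t : ℝ) * Complex.I)) : ℂ) : OnePoint ℂ)

/-- `ρ` is a monodromy matrix of `F` around the end `e`: continuation of `F` along a circle around
`e` gives `F ρ`. -/
def IsMonodromy (S : Face.{u} k lam c) (e : End)
    (ρ : Matrix.SpecialLinearGroup (Fin 2) ℂ) : Prop :=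
  ∃ σ : unitInterval → S.X, S.IsLiftedCircle e σ ∧ S.F (σ 1) = S.F (σ 0) * ρ

/-- The end `e` is elliptic: the monodromy of `F` around it is elliptic. -/
def EllipticEnd (S : Face.{u} k lam c) (e : End) : Prop :=
  (∃ ρ, S.IsMonodromy e ρ) ∧ ∀ ρ, S.IsMonodromy e ρ → IsElliptic ρ

/-- The end `e` is hyperbolic: the monodromy of `F` around it is hyperbolic. -/
def HyperbolicEnd (S : Face.{u} k lam c) (e : End) : Prop :=
  (∃ ρ, S.IsMonodromy e ρ) ∧ ∀ ρ, S.IsMonodromy e ρ → IsHyperbolic ρ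

end Face

/-! ### The discriminant and the table -/

/-- The number `1 - 4 c (k+1) lam ^ (k/(k+1))`. -/
def disc (k : ℕ) (lam c : ℝ) : ℝ := 1 - 4 * c * ((k : ℝ) + 1) * scale k lam

/-- The middle column of the table (`lam = 2`); the entry of index `i` belongs to `k = i + 1`. -/
def middleColumn : Fin 20 → ℝ :=
  ![-0.557726, -0.505010, -0.483326, -0.471988, -0.465097, -0.460530, -0.457291, -0.454881,
    -0.453020, -0.451543, -0.450342, -0.449348, -0.448511, -0.447797, -0.447182, -0.446645,
    -0.446173, -0.445756, -0.445383, -0.445049]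

/-- The right hand column of the table (`lam = 2`); the entry of index `i` belongs to
`k = i + 1`. -/
def rightColumn : Fin 20 → ℝ :=
  ![0.704094, 0.548964, 0.482090, 0.444727, 0.420845, 0.404255, 0.392055, 0.382705,
    0.375309, 0.369312, 0.364352, 0.360180, 0.356623, 0.353553, 0.350878, 0.348525,
    0.346439, 0.344578, 0.342907, 0.341398]

end CMCFace

end

/-!
Write `s = scale k lam` and `θ = z d/dz`. If `(F₁, F₂)` is a column of a solution and
`U = (F₁ - G F₂) / w`, `v = F₂`, the equation becomes `θ v = c U`, `θ U = -q (U + s v)` with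
`q = θ w / w`, a rational function of `z` that is regular at `z = 0`: the multivalued function `w`
has disappeared. So `v` solves `θ² v + q (θ v + s c v) = 0`, which has a regular singular point at
`z = 0` with exponents `(-1 ± δ) / (2 (k + 1))`, `δ ^ 2 = disc k lam c`. If `disc` is not the square
of an integer multiple of `k + 1`, the exponents do not differ by an integer, and both of them
belong to Frobenius solutions `z ^ m ∑ a_n z ^ n` (`frobeniusCoeff`, `summable_frobeniusCoeff`).

A small circle around the end `(0, 0)` in the coordinate `ζ` is a circle around `z = 0` that is run
through `k + 1` times. Along it the two Frobenius solutions are multiplied by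
`exp (2 π i (k + 1) m) = - exp (± π i δ)`. They are independent, because the mean value over the
circle of the factor of their Wronskian that is a power series is the difference of the exponents
(`exists_wronskian_ne_zero`). The system has trace zero, so that the Wronskians of the Frobenius
solutions with the columns of `F` are constant along the circle; this shows that the monodromy `ρ`
is similar to a diagonal matrix with entries `- exp (± π i δ)` (`exists_monodromy_diagonal`), and in
particular is `± 1` when these coincide. The involution `(z, w) ↦ (1 / z, 1 / (s² w))` of the
curve, combined with the exchange of the rows of `F`, reduces the end `(∞, ∞)` to the end `(0, 0)`
(`connectionMatrix_mul_apply`).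

Since the surface is defined on `M`, `ρ` lies in `SU(1,1)`, where the trace decides the type: it is
`-2 cos (π δ)` for real `δ ≠ 0`, and `-2 cosh (π |δ|)` for imaginary `δ` (`isElliptic_of_trace`,
`isHyperbolic_of_trace`). For the tables, elementary bounds for `2 ^ (k / (k + 1))` place `disc`
between the squares of consecutive multiples of `k + 1`, or make it negative.
-/

namespace CMCFace

/-! ### The Frobenius recursion and its convergence -/

/-- The coefficients `a n`, with `a 0 = 1`, of the Frobenius series `∑ a n z ^ (m + n)` of the
equation `θ² v + q (θ v + d v) = 0`, `θ = z d/dz`, where `q` is given by its Taylor coefficients.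
The denominator `n (n + 2 m + q 0)` is the indicial polynomial at `m + n`, for a root `m`. -/
noncomputable def frobeniusCoeff (q : ℕ → ℂ) (m d : ℂ) : ℕ → ℂ
  | 0 => 1
  | n + 1 => -(∑ j : Fin (n + 1), q (n + 1 - j) * ((m + (j : ℕ) + d) * frobeniusCoeff q m d j)) /
      ((n + 1 : ℂ) * (n + 1 + 2 * m + q 0))
  decreasing_by exact j.2

theorem frobeniusCoeff_zero (q : ℕ → ℂ) (m d : ℂ) : frobeniusCoeff q m d 0 = 1 := by
  rw [frobeniusCoeff]

theorem frobeniusCoeff_of_pos (q : ℕ → ℂ) (m d : ℂ) {n : ℕ} (hn : 1 ≤ n) :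
    frobeniusCoeff q m d n =
      -(∑ j ∈ Finset.range n, q (n - j) * ((m + j + d) * frobeniusCoeff q m d j)) /
        ((n : ℂ) * (n + 2 * m + q 0)) := by
  obtain ⟨n, rfl⟩ : ∃ l, n = l + 1 := ⟨n - 1, by omega⟩
  rw [frobeniusCoeff, Fin.sum_univ_eq_sum_range
    (fun j => q (n + 1 - j) * ((m + (j : ℂ) + d) * frobeniusCoeff q m d j)) (n + 1)]
  push_cast
  rfl

/-- The series with coefficients `frobeniusCoeff` solves `θ² v + q (θ v + d v) = 0` formally, where
`θ = z d/dz` acts on `z ^ (m + n)` as multiplication by `m + n`. -/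
theorem frobeniusCoeff_recursion {q : ℕ → ℂ} {m d : ℂ} (hm : m ^ 2 + q 0 * (m + d) = 0)
    (hn : ∀ n : ℕ, 1 ≤ n → (n + 2 * m + q 0 : ℂ) ≠ 0) (n : ℕ) :
    (m + n) ^ 2 * frobeniusCoeff q m d n +
      ∑ p ∈ Finset.HasAntidiagonal.antidiagonal n,
        q p.1 * ((m + p.2 + d) * frobeniusCoeff q m d p.2) = 0 := by
  have e : ∑ p ∈ Finset.HasAntidiagonal.antidiagonal n,
      q p.1 * ((m + p.2 + d) * frobeniusCoeff q m d p.2) =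
      ∑ j ∈ Finset.range (n + 1), q (n - j) * ((m + j + d) * frobeniusCoeff q m d j) := by
    rw [Finset.Nat.antidiagonal_eq_map', Finset.sum_map]
    rfl
  rw [e, Finset.sum_range_succ, Nat.sub_self]
  rcases Nat.eq_zero_or_pos n with rfl | hpos
  · rw [frobeniusCoeff_zero]
    simp only [Finset.range_zero, Finset.sum_empty, Nat.cast_zero]
    linear_combination hm
  · have h1 := frobeniusCoeff_of_pos q m d hpos
    have h2 := hn n hpos
    have h3 : (n : ℂ) ≠ 0 := by exact_mod_cast hpos.ne'
    rw [eq_div_iff (mul_ne_zero h3 h2)] at h1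
    linear_combination h1 + frobeniusCoeff q m d n * hm

/-- If the coefficients of `q` are `O(L ^ n)`, those of the Frobenius series are `O(S ^ n)` for
every `S > L`: for large `n` the indicial polynomial is at least `n ^ 2 / 2`, and the bound
propagates by induction. -/
theorem exists_norm_frobeniusCoeff_le {q : ℕ → ℂ} (m d : ℂ) {C L S : ℝ} (hL : 0 < L) (hS : L < S)
    (hC : 0 ≤ C) (hq : ∀ n, ‖q n‖ ≤ C * L ^ n) :
    ∃ A : ℝ, 0 ≤ A ∧ ∀ n, ‖frobeniusCoeff q m d n‖ ≤ A * S ^ n := by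
  have hS0 : 0 < S := hL.trans hS
  set D : ℝ := ‖m‖ + ‖d‖ + 1
  have hD : 0 < D := by positivity
  set T : ℝ := L / (S - L)
  have hT : 0 ≤ T := div_nonneg hL.le (by linarith)
  -- from the index `N` on, the recursion does not increase the ratio to `S ^ n`
  obtain ⟨N, hN⟩ := exists_nat_ge (2 * ‖2 * m + q 0‖ + 2 * C * D * T + 1)
  have key : ∀ n : ℕ, ∑ j ∈ Finset.range n, L ^ (n - j) * S ^ j ≤ T * S ^ n := by
    intro n
    have h0 : ∀ n : ℕ, (S - L) * ∑ j ∈ Finset.range n, L ^ (n - j) * S ^ j =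
        L * (S ^ n - L ^ n) := by
      intro n
      induction n with
      | zero => simp
      | succ n ih =>
        have e : ∑ j ∈ Finset.range n, L ^ (n + 1 - j) * S ^ j =
            L * ∑ j ∈ Finset.range n, L ^ (n - j) * S ^ j := by
          rw [Finset.mul_sum]
          refine Finset.sum_congr rfl fun j hj => ?_
          rw [Finset.mem_range] at hj
          rw [show n + 1 - j = (n - j) + 1 by omega]
          ring
        rw [Finset.sum_range_succ, e, show n + 1 - n = 1 by omega]
        linear_combination L * ih
    have h1 := h0 n
    have h2 : 0 < S - L := by linarith
    rw [show T * S ^ n = L * S ^ n / (S - L) by simp only [T]; ring, le_div_iff₀ h2]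
    have : 0 < L ^ n := by positivity
    nlinarith
  refine ⟨∑ j ∈ Finset.range (N + 1), ‖frobeniusCoeff q m d j‖ / S ^ j,
    Finset.sum_nonneg fun j _ => by positivity, fun n => ?_⟩
  set A : ℝ := ∑ j ∈ Finset.range (N + 1), ‖frobeniusCoeff q m d j‖ / S ^ j
  have hA : 0 ≤ A := Finset.sum_nonneg fun j _ => by positivity
  induction n using Nat.strong_induction_on with
  | _ n ih =>
    rcases lt_or_ge n (N + 1) with hlt | hge
    · rw [← div_le_iff₀ (by positivity)]
      exact Finset.single_le_sum (f := fun j => ‖frobeniusCoeff q m d j‖ / S ^ j)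
        (fun j _ => by positivity) (Finset.mem_range.2 hlt)
    · have hn1 : 1 ≤ n := by omega
      have hnN : (N : ℝ) + 1 ≤ n := by exact_mod_cast hge
      have hn0 : (0 : ℝ) < n := by positivity
      have h1 : (n : ℝ) / 2 ≤ ‖(n + 2 * m + q 0 : ℂ)‖ := by
        have := norm_sub_le_norm_add (n : ℂ) (2 * m + q 0)
        rw [Complex.norm_natCast, ← add_assoc] at this
        have : 0 ≤ 2 * C * D * T := by positivity
        linarith
      have h2 : ‖∑ j ∈ Finset.range n, q (n - j) * ((m + j + d) * frobeniusCoeff q m d j)‖ ≤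
          C * (D * n) * A * (T * S ^ n) := by
        calc _ ≤ ∑ j ∈ Finset.range n, C * (D * n) * A * (L ^ (n - j) * S ^ j) := by
              refine norm_sum_le_of_le _ fun j hj => ?_
              rw [Finset.mem_range] at hj
              have hjn : (j : ℝ) ≤ n := by exact_mod_cast hj.le
              have h1n : (1 : ℝ) ≤ n := by exact_mod_cast hn1
              have hb : ‖m + (j : ℂ) + d‖ ≤ D * n := by
                have := norm_add₃_le (a := m) (b := (j : ℂ)) (c := d)
                rw [Complex.norm_natCast] at this
                have h3 : ‖m‖ ≤ ‖m‖ * n := le_mul_of_one_le_right (norm_nonneg _) h1n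
                have h4 : ‖d‖ ≤ ‖d‖ * n := le_mul_of_one_le_right (norm_nonneg _) h1n
                simp only [D]
                nlinarith
              rw [norm_mul, norm_mul]
              calc _ ≤ C * L ^ (n - j) * (D * n * (A * S ^ j)) := by
                    gcongr
                    · exact hq _
                    · exact ih j hj
                _ = _ := by ring
          _ ≤ _ := by
              rw [← Finset.mul_sum]
              gcongr
              exact key n
      rw [frobeniusCoeff_of_pos q m d hn1, norm_div, norm_neg, norm_mul, Complex.norm_natCast]
      have h3 : 0 < (n : ℝ) * ‖(n + 2 * m + q 0 : ℂ)‖ := by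
        have : 0 < (n : ℝ) / 2 := by positivity
        exact mul_pos hn0 (this.trans_le h1)
      rw [div_le_iff₀ h3]
      refine h2.trans ?_
      have h4 : 2 * C * D * T ≤ n := by
        have := norm_nonneg (2 * m + q 0)
        linarith
      calc C * (D * n) * A * (T * S ^ n) = A * S ^ n * (n * (2 * C * D * T / 2)) := by ring
        _ ≤ A * S ^ n * (n * (n / 2)) := by gcongr
        _ ≤ _ := by gcongr

theorem summable_frobeniusCoeff {q : ℕ → ℂ} (m d : ℂ) {C L R : ℝ} (hL : 0 < L) (hC : 0 ≤ C)
    (hq : ∀ n, ‖q n‖ ≤ C * L ^ n) (hR : 0 ≤ R) (hRL : R * L < 1) (l : ℕ) :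
    Summable fun n : ℕ => (n : ℝ) ^ l * (‖frobeniusCoeff q m d n‖ * R ^ n) := by
  obtain ⟨S, hS, hRS⟩ : ∃ S, L < S ∧ R * S < 1 := by
    rcases hR.eq_or_lt with rfl | hR
    · exact ⟨L + 1, by linarith, by simp⟩
    · obtain ⟨S, h1, h2⟩ := exists_between ((lt_div_iff₀' hR).2 hRL)
      exact ⟨S, h1, (lt_div_iff₀' hR).1 h2⟩
  obtain ⟨A, hA, hb⟩ := exists_norm_frobeniusCoeff_le m d hL hS hC hq
  have hS0 : 0 < S := hL.trans hS
  have h1 : ‖R * S‖ < 1 := by rwa [Real.norm_of_nonneg (by positivity)]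
  refine Summable.of_nonneg_of_le (fun n => by positivity) (fun n => ?_)
    ((summable_pow_mul_geometric_of_norm_lt_one l h1).mul_left A)
  calc _ ≤ (n : ℝ) ^ l * (A * S ^ n * R ^ n) := by gcongr; exact hb n
    _ = _ := by rw [mul_pow]; ring

/-! ### Power series on a circle -/

/-- The circle of radius `R`, run through `N` times as `t` goes from `0` to `1`. -/
noncomputable def loop (N : ℕ) (R t : ℝ) : ℂ := R * Complex.exp (2 * Real.pi * N * t * Complex.I)

theorem norm_loop (N : ℕ) {R : ℝ} (hR : 0 ≤ R) (t : ℝ) : ‖loop N R t‖ = R := by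
  have : (2 * Real.pi * N * t * Complex.I : ℂ) = ((2 * Real.pi * N * t : ℝ) : ℂ) * Complex.I := by
    push_cast; ring
  rw [loop, this, norm_mul, Complex.norm_exp_ofReal_mul_I, mul_one, Complex.norm_real,
    Real.norm_of_nonneg hR]

theorem loop_zero (N : ℕ) (R : ℝ) : loop N R 0 = R := by simp [loop]

theorem loop_one (N : ℕ) (R : ℝ) : loop N R 1 = R := by
  have : (2 * Real.pi * N * (1 : ℝ) * Complex.I : ℂ) = N * (2 * Real.pi * Complex.I) := by
    push_cast; ring
  rw [loop, this, Complex.exp_nat_mul_two_pi_mul_I, mul_one]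

theorem loop_pow (N : ℕ) (R t : ℝ) (n : ℕ) : loop N R t ^ n = loop (n * N) (R ^ n) t := by
  simp only [loop, mul_pow, ← Complex.exp_nat_mul]
  push_cast
  ring_nf

theorem hasDerivAt_loop (N : ℕ) (R t : ℝ) :
    HasDerivAt (loop N R) (2 * Real.pi * N * Complex.I * loop N R t) t := by
  have h1 : HasDerivAt (fun t : ℝ => (2 * Real.pi * N * t * Complex.I : ℂ))
      (2 * Real.pi * N * Complex.I) t := by
    have := ((Complex.ofRealCLM.hasDerivAt (x := t)).const_mul
      (2 * Real.pi * N : ℂ)).mul_const Complex.I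
    simpa using this
  refine (h1.cexp.const_mul (R : ℂ)).congr_deriv ?_
  rw [loop]
  ring

theorem continuous_loop (N : ℕ) (R : ℝ) : Continuous (loop N R) :=
  continuous_iff_continuousAt.2 fun t => (hasDerivAt_loop N R t).continuousAt

theorem hasDerivAt_tsum_loop (N : ℕ) {R : ℝ} (hR : 0 ≤ R) {a : ℕ → ℂ}
    (h0 : Summable fun n => ‖a n‖ * R ^ n) (h1 : Summable fun n : ℕ => (n : ℝ) * (‖a n‖ * R ^ n))
    (t : ℝ) :
    HasDerivAt (fun t => ∑' n, a n * loop N R t ^ n)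
      (2 * Real.pi * N * Complex.I * ∑' n : ℕ, (n * a n) * loop N R t ^ n) t := by
  have hd : ∀ (n : ℕ) (t : ℝ), HasDerivAt (fun t => a n * loop N R t ^ n)
      (2 * Real.pi * N * Complex.I * ((n * a n) * loop N R t ^ n)) t := by
    intro n t
    rcases Nat.eq_zero_or_pos n with rfl | hn
    · simpa using hasDerivAt_const t (a 0)
    · refine (((hasDerivAt_loop N R t).pow n).const_mul (a n)).congr_deriv ?_
      obtain ⟨l, rfl⟩ : ∃ l, n = l + 1 := ⟨n - 1, by omega⟩
      rw [Nat.add_sub_cancel]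
      ring
  rw [← tsum_mul_left]
  refine hasDerivAt_tsum (h1.mul_left (2 * Real.pi * N)) hd (fun n t => ?_) (y₀ := 0) ?_ t
  · simp only [norm_mul, norm_pow, norm_loop N hR, Complex.norm_natCast, Complex.norm_I,
      Complex.norm_real, Complex.norm_two, Real.norm_of_nonneg Real.pi_pos.le, mul_one]
    apply le_of_eq; ring
  · refine Summable.of_norm ?_
    simpa only [norm_mul, norm_pow, norm_loop N hR] using h0

/-- Mean value property: a power series that vanishes on a circle has constant term `0`. -/
theorem eq_zero_of_tsum_loop_eq_zero {N : ℕ} (hN : N ≠ 0) {R : ℝ} (hR : 0 ≤ R) {a : ℕ → ℂ}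
    (h0 : Summable fun n => ‖a n‖ * R ^ n)
    (h : ∀ t, ∑' n, a n * loop N R t ^ n = 0) : a 0 = 0 := by
  have hint : ∀ n : ℕ, ∫ t in (0 : ℝ)..1, a n * loop N R t ^ n = if n = 0 then a 0 else 0 := by
    intro n
    rcases eq_or_ne n 0 with rfl | hn
    · simp
    · rw [if_neg hn, intervalIntegral.integral_const_mul]
      set K : ℂ := 2 * Real.pi * (n * N : ℕ) * Complex.I
      have hK : K ≠ 0 := by
        simp only [K]
        have : (Real.pi : ℂ) ≠ 0 := by exact_mod_cast Real.pi_ne_zero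
        simp [this, Complex.I_ne_zero, hn, hN]
      have hd : ∀ t ∈ Set.uIcc (0 : ℝ) 1,
          HasDerivAt (fun t => loop (n * N) (R ^ n) t / K) (loop N R t ^ n) t := by
        intro t _
        refine ((hasDerivAt_loop (n * N) (R ^ n) t).div_const K).congr_deriv ?_
        rw [loop_pow, mul_div_assoc, mul_div_assoc', mul_div_cancel_left₀ _ hK]
      rw [intervalIntegral.integral_eq_sub_of_hasDerivAt hd
        (((continuous_loop N R).pow n).intervalIntegrable _ _), loop_zero, loop_one, sub_self,
        mul_zero]
  have hs := intervalIntegral.hasSum_intervalIntegral_of_summable_norm (a := 0) (b := 1)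
    (f := fun n => (⟨fun t => a n * loop N R t ^ n,
      continuous_const.mul ((continuous_loop N R).pow n)⟩ : C(ℝ, ℂ))) ?_
  · simp only [ContinuousMap.coe_mk, hint, h, intervalIntegral.integral_zero] at hs
    exact (hasSum_ite_eq 0 (a 0)).unique hs
  · refine Summable.of_nonneg_of_le (fun n => norm_nonneg _) (fun n => ?_) h0
    refine (ContinuousMap.norm_le _ (by positivity)).2 fun t => ?_
    simp [norm_loop N hR]

/-! ### Elliptic and hyperbolic elements of SU(1,1) -/

open scoped ComplexConjugate

theorem entries_of_mem_SU11 {ρ : Matrix.SpecialLinearGroup (Fin 2) ℂ} (h : ρ ∈ SU11) :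
    ρ.1 1 0 = conj (ρ.1 0 1) ∧ ρ.1 1 1 = conj (ρ.1 0 0) ∧
      ρ.1 0 0 * conj (ρ.1 0 0) - ρ.1 0 1 * conj (ρ.1 0 1) = 1 := by
  have hd : ρ.1 0 0 * ρ.1 1 1 - ρ.1 0 1 * ρ.1 1 0 = 1 := by
    rw [← Matrix.det_fin_two]; exact ρ.2
  have h : hermitianOrbit ρ = e3 := h
  have h0 := congrFun (congrFun h 0) 0
  have h1 := congrFun (congrFun h 1) 0
  simp only [hermitianOrbit, e3, Matrix.mul_apply, Fin.sum_univ_two, Matrix.conjTranspose_apply,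
    Matrix.of_apply, Matrix.cons_val', Matrix.cons_val_zero, Matrix.cons_val_one,
    Matrix.cons_val_fin_one, mul_one, mul_zero, add_zero, zero_add, mul_neg, neg_mul,
    RCLike.star_def] at h0 h1
  refine ⟨?_, ?_, by linear_combination h0⟩
  · linear_combination -(ρ.1 1 0) * h0 + ρ.1 0 0 * h1 + conj (ρ.1 0 1) * hd
  · linear_combination -(ρ.1 1 1) * h0 + ρ.1 0 1 * h1 + conj (ρ.1 0 0) * hd

/-- The element `[[p, q], [q̄, p̄]]` of `SU(1,1)`. -/
noncomputable def mkSU11 (p q : ℂ) (h : p * conj p - q * conj q = 1) :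
    Matrix.SpecialLinearGroup (Fin 2) ℂ :=
  ⟨!![p, q; conj q, conj p], by rw [Matrix.det_fin_two_of]; exact h⟩

theorem mkSU11_mem (p q : ℂ) (h : p * conj p - q * conj q = 1) : mkSU11 p q h ∈ SU11 := by
  change hermitianOrbit _ = e3
  ext i j
  fin_cases i <;> fin_cases j <;>
  simp [hermitianOrbit, e3, mkSU11, Matrix.mul_apply, Fin.sum_univ_two] <;>
  first
  | ring1
  | linear_combination h
  | linear_combination -h

/-- A relation `ρ P = P D` in `SU(1,1)`, with `P = [[p, q], [q̄, p̄]]` and `D = [[u, v], [v̄, ū]]`,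
can be checked on the first row. -/
theorem conj_mkSU11 {ρ : Matrix.SpecialLinearGroup (Fin 2) ℂ} (hρ : ρ ∈ SU11) {p q u v : ℂ}
    (h : p * conj p - q * conj q = 1)
    (h0 : ρ.1 0 0 * p + ρ.1 0 1 * conj q = p * u + q * conj v)
    (h1 : ρ.1 0 0 * q + ρ.1 0 1 * conj p = p * v + q * conj u) :
    (((mkSU11 p q h)⁻¹ * ρ * mkSU11 p q h : Matrix.SpecialLinearGroup (Fin 2) ℂ) :
      Matrix (Fin 2) (Fin 2) ℂ) = !![u, v; conj v, conj u] := by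
  obtain ⟨e1, e2, -⟩ := entries_of_mem_SU11 hρ
  have key : (ρ : Matrix (Fin 2) (Fin 2) ℂ) * (mkSU11 p q h : Matrix (Fin 2) (Fin 2) ℂ) =
      (mkSU11 p q h : Matrix (Fin 2) (Fin 2) ℂ) * !![u, v; conj v, conj u] := by
    have h0' := congrArg conj h0
    have h1' := congrArg conj h1
    simp only [map_add, map_mul, Complex.conj_conj] at h0' h1'
    ext i j
    fin_cases i <;> fin_cases j <;>
    simp [mkSU11, Matrix.mul_apply, Fin.sum_univ_two] <;>
    first
    | linear_combination h0
    | linear_combination h1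
    | (rw [e1, e2]; linear_combination h0')
    | (rw [e1, e2]; linear_combination h1')
  rw [mul_assoc, Matrix.SpecialLinearGroup.coe_mul, Matrix.SpecialLinearGroup.coe_mul, key,
    ← Matrix.mul_assoc, ← Matrix.SpecialLinearGroup.coe_mul, inv_mul_cancel]
  simp

/-- An element of `SU(1,1)` with trace `2 cos θ` strictly between `-2` and `2` is elliptic: the
eigenvector for the eigenvalue `e^{iθ}`, for the right sign of `θ`, is positive for the
Hermitian form of signature `(1,1)`. -/
theorem isElliptic_of_trace {ρ : Matrix.SpecialLinearGroup (Fin 2) ℂ} (hρ : ρ ∈ SU11) {θ : ℝ}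
    (hθ : Real.sin θ ≠ 0) (htr : ρ.1 0 0 + ρ.1 1 1 = 2 * Real.cos θ) : IsElliptic ρ := by
  obtain ⟨e1, e2, e3⟩ := entries_of_mem_SU11 hρ
  set a := ρ.1 0 0 with ha
  set b := ρ.1 0 1 with hb
  have hre : a.re = Real.cos θ := by
    rw [e2, Complex.add_conj] at htr
    have : 2 * a.re = 2 * Real.cos θ := by exact_mod_cast htr
    linarith
  have hnorm : a.re ^ 2 + a.im ^ 2 - (b.re ^ 2 + b.im ^ 2) = 1 := by
    rw [Complex.mul_conj, Complex.mul_conj, Complex.normSq_apply, Complex.normSq_apply] at e3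
    have : a.re * a.re + a.im * a.im - (b.re * b.re + b.im * b.im) = 1 := by exact_mod_cast e3
    linarith
  have hsc := Real.sin_sq_add_cos_sq θ
  rw [hre] at hnorm
  have him : Real.sin θ ^ 2 ≤ a.im ^ 2 := by nlinarith [sq_nonneg b.re, sq_nonneg b.im]
  -- the sign of `φ = ± θ` is that of `Im a`
  obtain ⟨φ, hφ, hcos, hpos⟩ : ∃ φ : ℝ, Real.sin φ ^ 2 = Real.sin θ ^ 2 ∧
      Real.cos φ = Real.cos θ ∧ 0 < Real.sin φ * a.im := by
    have h0 : Real.sin θ * a.im ≠ 0 := by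
      refine mul_ne_zero hθ fun h => ?_
      rw [h] at him
      have := sq_pos_of_pos (abs_pos.2 hθ)
      rw [sq_abs] at this
      nlinarith
    rcases lt_or_gt_of_ne h0 with h | h
    · exact ⟨-θ, by simp, by simp, by simpa using h⟩
    · exact ⟨θ, rfl, rfl, h⟩
  have hsφ : Real.sin φ ≠ 0 := fun h => by simp [h] at hpos
  set S := Real.sin φ
  have hS2 : 0 < S ^ 2 := by positivity
  set N := a.im + S
  have hN : 0 < S * N := by simp only [N]; nlinarith
  have hN0 : N ≠ 0 := fun h => by simp [h] at hN
  have hb2 : b.re ^ 2 + b.im ^ 2 = (a.im - S) * N := by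
    simp only [N]
    nlinarith
  have hq0 : 0 < N / (2 * S) := by
    rw [show N / (2 * S) = S * N / (2 * S ^ 2) by field_simp]
    positivity
  set p : ℝ := Real.sqrt (N / (2 * S))
  have hp2 : (p : ℂ) ^ 2 = N / (2 * S) := by
    have := Real.sq_sqrt hq0.le
    exact_mod_cast this
  have hSc : (S : ℂ) ≠ 0 := by exact_mod_cast hsφ
  have hNc : (N : ℂ) ≠ 0 := by exact_mod_cast hN0
  have hNa : (N : ℂ) = a.im + S := by simp [N]
  have hbc : b * conj b = (a.im - S) * N := by
    rw [Complex.mul_conj, Complex.normSq_apply]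
    have : b.re * b.re + b.im * b.im = (a.im - S) * N := by linarith
    exact_mod_cast this
  have haa : a = Real.cos φ + a.im * Complex.I := by
    rw [hcos, ← hre]; exact (Complex.re_add_im a).symm
  have hI := Complex.I_sq
  set q : ℂ := p * b * Complex.I / N
  have hqc : conj q = -(p * conj b * Complex.I / N) := by
    simp [q]
    ring
  have hpc : conj (p : ℂ) = p := Complex.conj_ofReal p
  have hdet : (p : ℂ) * conj (p : ℂ) - q * conj q = 1 := by
    rw [hqc, hpc]
    have h1 : q * -(p * conj b * Complex.I / N) = p ^ 2 * (b * conj b) / N ^ 2 := by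
      simp only [q]
      field_simp
      linear_combination (-(p ^ 2 * b * conj b)) * hI
    rw [h1, hbc, ← pow_two, hp2]
    field_simp
    rw [hNa]
    ring
  have hexp : Complex.exp (φ * Complex.I) = Real.cos φ + S * Complex.I := by
    rw [Complex.exp_mul_I]
    simp [S]
  have hexpc : conj (Complex.exp (φ * Complex.I)) = Real.cos φ - S * Complex.I := by
    rw [hexp, map_add, map_mul, Complex.conj_ofReal, Complex.conj_ofReal, Complex.conj_I]
    ring
  refine ⟨mkSU11 p q hdet, mkSU11_mem _ _ _, φ, ?_⟩
  have hc : Complex.exp (-(φ * Complex.I)) = conj (Complex.exp (φ * Complex.I)) := by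
    rw [← Complex.exp_conj]
    simp
  rw [conj_mkSU11 hρ (u := Complex.exp (φ * Complex.I)) (v := 0), hc, map_zero]
  · rw [← ha, ← hb, hqc, hexp, haa, map_zero]
    simp only [q]
    field_simp
    linear_combination (-(p * Complex.I : ℂ)) * hbc
  · rw [← ha, ← hb, hpc, hexpc, haa]
    simp only [q]
    field_simp
    rw [hNa]
    linear_combination (p * b * (a.im + S) : ℂ) * hI

/-- An element of `SU(1,1)` with trace `± 2 cosh s`, `s > 0`, is hyperbolic. -/
theorem isHyperbolic_of_trace {ρ : Matrix.SpecialLinearGroup (Fin 2) ℂ} (hρ : ρ ∈ SU11) {s : ℝ}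
    (hs : 0 < s) {ε : ℂ} (hε : ε = 1 ∨ ε = -1)
    (htr : ρ.1 0 0 + ρ.1 1 1 = ε * (2 * Real.cosh s)) : IsHyperbolic ρ := by
  obtain ⟨e1, e2, e3⟩ := entries_of_mem_SU11 hρ
  have hεε : ε * ε = 1 := by rcases hε with rfl | rfl <;> simp
  have hεc : conj ε = ε := by rcases hε with rfl | rfl <;> simp
  -- the entries of `ε ρ`, which has trace `2 cosh s`
  obtain ⟨a, ha⟩ : ∃ a, a = ε * ρ.1 0 0 := ⟨_, rfl⟩
  obtain ⟨b, hb⟩ : ∃ b, b = ε * ρ.1 0 1 := ⟨_, rfl⟩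
  have ha' : ρ.1 0 0 = ε * a := by rw [ha, ← mul_assoc, hεε, one_mul]
  have hb' : ρ.1 0 1 = ε * b := by rw [hb, ← mul_assoc, hεε, one_mul]
  rw [ha', hb', map_mul, map_mul, hεc] at e3
  have e3 : a * conj a - b * conj b = 1 := by
    linear_combination e3 + (b * conj b - a * conj a) * hεε
  have htr' : a + conj a = 2 * Real.cosh s := by
    rw [ha, map_mul, hεc, ← e2]
    linear_combination ε * htr + 2 * Real.cosh s * hεε
  have hre : a.re = Real.cosh s := by
    rw [Complex.add_conj] at htr'
    have : 2 * a.re = 2 * Real.cosh s := by exact_mod_cast htr'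
    linarith
  set h := Real.sinh s
  have hh : 0 < h := Real.sinh_pos_iff.2 hs
  have hch : (Real.cosh s : ℂ) ^ 2 = h ^ 2 + 1 := by
    have := Real.cosh_sq s
    exact_mod_cast this
  have haa : a = Real.cosh s + a.im * Complex.I := by
    rw [← hre]; exact (Complex.re_add_im a).symm
  have haac : conj a = Real.cosh s - a.im * Complex.I := by
    linear_combination htr' - haa
  have hI := Complex.I_sq
  have hcc : (h - a.im * Complex.I : ℂ) * (h + a.im * Complex.I) = b * conj b := by
    rw [haac] at e3
    linear_combination e3 - hch - (Real.cosh s - a.im * Complex.I : ℂ) * haa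
  have hconj : conj (h - a.im * Complex.I : ℂ) = h + a.im * Complex.I := by simp
  have hne : (h - a.im * Complex.I : ℂ) ≠ 0 := by
    intro h0
    have := congrArg Complex.re h0
    simp at this
    exact hh.ne' this
  have hne' : (h + a.im * Complex.I : ℂ) ≠ 0 := by
    rw [← hconj]; exact (map_ne_zero _).2 hne
  have hhc : (h : ℂ) ≠ 0 := by exact_mod_cast hh.ne'
  -- a unit square root `X` of the unit complex number `b / (sinh s - i Im a)`
  obtain ⟨X, hX2, hX1⟩ : ∃ X : ℂ, (h - a.im * Complex.I) * X ^ 2 = b ∧ X * conj X = 1 := by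
    obtain ⟨X, hX⟩ := IsAlgClosed.exists_pow_nat_eq (b / (h - a.im * Complex.I)) (n := 2) (by simp)
    refine ⟨X, by rw [hX, mul_div_cancel₀ _ hne], ?_⟩
    have h1 : (X * conj X) ^ 2 = 1 := by
      rw [mul_pow, ← map_pow, hX, map_div₀, hconj, div_mul_div_comm, hcc, div_self]
      rw [← hcc]
      exact mul_ne_zero hne hne'
    rw [Complex.mul_conj] at h1 ⊢
    have h2 : Complex.normSq X ^ 2 = 1 := by exact_mod_cast h1
    have h3 : Complex.normSq X = 1 := by
      nlinarith [Complex.normSq_nonneg X]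
    rw [h3, Complex.ofReal_one]
  -- `X` and `Y` are the sum and the difference of the first row of the conjugating matrix
  set Y : ℂ := X * (h - a.im * Complex.I) / h
  have hYc : conj Y = conj X * (h + a.im * Complex.I) / h := by
    simp only [Y, map_div₀, map_mul, hconj, Complex.conj_ofReal]
  have hX3 : b * conj X = (h - a.im * Complex.I) * X := by
    linear_combination (-conj X) * hX2 + (h - a.im * Complex.I) * X * hX1
  have hY3 : b * conj Y = (h + a.im * Complex.I) * Y := by
    rw [hYc]
    simp only [Y]
    field_simp
    linear_combination hX3
  set p : ℂ := (X + Y) / 2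
  set q : ℂ := (X - Y) / 2
  have hpc : conj p = (conj X + conj Y) / 2 := by simp [p, Complex.conj_ofNat]
  have hqc : conj q = (conj X - conj Y) / 2 := by simp [q, Complex.conj_ofNat]
  have hdet : p * conj p - q * conj q = 1 := by
    rw [hpc, hqc, hYc]
    simp only [p, q, Y]
    field_simp
    linear_combination (4 * h ^ 2) * hX1
  refine ⟨mkSU11 p q hdet, mkSU11_mem _ _ _, s, hs, ε, hε, ?_⟩
  rw [conj_mkSU11 hρ (u := ε * Real.cosh s) (v := ε * h)]
  · simp only [map_mul, Complex.conj_ofReal, hεc, Matrix.smul_of, Matrix.smul_cons,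
      Matrix.smul_empty, smul_eq_mul]
    rfl
  · rw [ha', hb', hqc, map_mul, hεc, Complex.conj_ofReal, haa]
    simp only [p, q]
    linear_combination (ε / 2) * hX3 - (ε / 2) * hY3
  · rw [ha', hb', hpc, map_mul, hεc, Complex.conj_ofReal, haa]
    simp only [p, q]
    linear_combination (ε / 2) * hX3 + (ε / 2) * hY3

theorem isElliptic_one : IsElliptic 1 := by
  refine ⟨1, ?_, 0, by simp [Matrix.one_fin_two]⟩
  change hermitianOrbit 1 = e3
  simp [hermitianOrbit]

theorem isElliptic_neg_one : IsElliptic (-1) := by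
  refine ⟨1, ?_, Real.pi, ?_⟩
  · change hermitianOrbit 1 = e3
    simp [hermitianOrbit]
  · rw [Complex.exp_neg, Complex.exp_pi_mul_I]
    ext i j
    fin_cases i <;> fin_cases j <;> simp

/-! ### The Frobenius series of the equation on a circle -/

/-- The Taylor coefficients of `z w' / w`, the logarithmic derivative along the curve. -/
noncomputable def logDerivCoeff (k : ℕ) (lam : ℝ) (n : ℕ) : ℂ :=
  ((if n = 0 then 1 else 0) + k * ((lam : ℂ)⁻¹ ^ n - (lam : ℂ) ^ n)) / (k + 1)

theorem logDerivCoeff_zero (k : ℕ) (lam : ℝ) : logDerivCoeff k lam 0 = 1 / (k + 1) := by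
  simp [logDerivCoeff]

theorem norm_logDerivCoeff_le (k : ℕ) {lam : ℝ} (hlam : 1 < lam) (n : ℕ) :
    ‖logDerivCoeff k lam n‖ ≤ 1 * lam ^ n := by
  have hk : (0 : ℝ) < k + 1 := by positivity
  have hk' : ‖(k + 1 : ℂ)‖ = k + 1 := by
    have : (k + 1 : ℂ) = ((k + 1 : ℝ) : ℂ) := by push_cast; rfl
    rw [this, Complex.norm_real, Real.norm_of_nonneg hk.le]
  rw [logDerivCoeff, norm_div, hk', div_le_iff₀ hk]
  rcases eq_or_ne n 0 with rfl | hn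
  · simp
  · have h1 : (1 : ℝ) ≤ lam ^ n := one_le_pow₀ hlam.le
    have h2 : (lam⁻¹ : ℝ) ^ n ≤ 1 := pow_le_one₀ (by positivity) (inv_le_one_of_one_le₀ hlam.le)
    have h3 : 0 < (lam⁻¹ : ℝ) ^ n := by positivity
    have e : ((lam : ℂ)⁻¹ ^ n - (lam : ℂ) ^ n) = (((lam⁻¹ : ℝ) ^ n - lam ^ n : ℝ) : ℂ) := by
      push_cast; rfl
    rw [if_neg hn, zero_add, e, norm_mul, Complex.norm_natCast, Complex.norm_real, Real.norm_eq_abs,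
      abs_of_nonpos (by linarith)]
    have hk0 : (0 : ℝ) ≤ k := by positivity
    nlinarith

theorem hasSum_logDerivCoeff (k : ℕ) {lam : ℝ} (hlam : 1 < lam) {x : ℂ} (hx : ‖x‖ < lam⁻¹) :
    HasSum (fun n => logDerivCoeff k lam n * x ^ n)
      ((1 + k * ((1 - (lam : ℂ)⁻¹ * x)⁻¹ - (1 - lam * x)⁻¹)) / (k + 1)) := by
  have hl : 0 < lam := by linarith
  have hl1 : lam⁻¹ < 1 := inv_lt_one_of_one_lt₀ hlam
  have h1 : ‖(lam : ℂ) * x‖ < 1 := by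
    rw [norm_mul, Complex.norm_real, Real.norm_of_nonneg hl.le]
    calc lam * ‖x‖ < lam * lam⁻¹ := by gcongr
      _ = 1 := mul_inv_cancel₀ hl.ne'
  have h2 : ‖(lam : ℂ)⁻¹ * x‖ < 1 := by
    rw [norm_mul, norm_inv, Complex.norm_real, Real.norm_of_nonneg hl.le]
    have := norm_nonneg x
    nlinarith [inv_pos.2 hl]
  have h3 := (((hasSum_geometric_of_norm_lt_one h2).sub
    (hasSum_geometric_of_norm_lt_one h1)).mul_left (k : ℂ))
  have h4 := ((hasSum_ite_eq (0 : ℕ) (1 : ℂ)).add h3).div_const (k + 1 : ℂ)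
  have e : (fun n : ℕ => ((if n = 0 then 1 else 0) +
      k * (((lam : ℂ)⁻¹ * x) ^ n - ((lam : ℂ) * x) ^ n)) / (k + 1)) =
      fun n => logDerivCoeff k lam n * x ^ n := by
    funext n
    rw [logDerivCoeff, mul_pow, mul_pow]
    split_ifs with h
    · simp [h]
    · ring
  rw [← e]
  exact h4

/-- The function `w` up to a constant factor `η` with `η ^ (k + 1) = (-1) ^ k`, along
the circle `|ζ| = r`, where `z = ζ ^ (k + 1)`: it is `ζ` times a branch, analytic for
`|z| < 1 / lam`, of `((1 - lam z) / (lam (lam - z))) ^ (k / (k + 1))`. -/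
noncomputable def branch (k : ℕ) (lam r t : ℝ) : ℂ :=
  loop 1 r t * Complex.exp (k / (k + 1) *
    (Complex.log (1 - lam * loop (k + 1) (r ^ (k + 1)) t) -
      Complex.log (lam * (lam - loop (k + 1) (r ^ (k + 1)) t))))

theorem branch_one (k : ℕ) (lam r : ℝ) : branch k lam r 1 = branch k lam r 0 := by
  rw [branch, branch, loop_one, loop_one, loop_zero, loop_zero]

theorem branch_ne_zero (k : ℕ) (lam : ℝ) {r : ℝ} (hr : 0 < r) (t : ℝ) : branch k lam r t ≠ 0 := by
  refine mul_ne_zero ?_ (Complex.exp_ne_zero _)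
  rw [← norm_ne_zero_iff, norm_loop 1 hr.le]
  exact hr.ne'

section

variable {k : ℕ} {lam r : ℝ}

theorem one_sub_mem_slitPlane (hlam : 1 < lam) {x : ℂ} (hx : ‖x‖ < lam⁻¹) :
    1 - lam * x ∈ Complex.slitPlane := by
  left
  have h1 := (Complex.re_le_norm x).trans_lt hx
  have hl : 0 < lam := by linarith
  have h2 : lam * x.re < lam * lam⁻¹ := by gcongr
  rw [mul_inv_cancel₀ hl.ne'] at h2
  simpa using h2

theorem mul_sub_mem_slitPlane (hlam : 1 < lam) {x : ℂ} (hx : ‖x‖ < lam⁻¹) :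
    lam * (lam - x) ∈ Complex.slitPlane := by
  left
  have h1 := (Complex.re_le_norm x).trans_lt (hx.trans (inv_lt_one_of_one_lt₀ hlam))
  have hl : 0 < lam := by linarith
  have h2 : 0 < lam * (lam - x.re) := mul_pos hl (by linarith)
  simpa using h2

theorem branch_pow (hlam : 1 < lam) (hr : 0 < r) (hr1 : r ^ (k + 1) < lam⁻¹) (t : ℝ) :
    branch k lam r t ^ (k + 1) = loop (k + 1) (r ^ (k + 1)) t *
      ((1 - lam * loop (k + 1) (r ^ (k + 1)) t) /
        (lam * (lam - loop (k + 1) (r ^ (k + 1)) t))) ^ k := by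
  have hx : ‖loop (k + 1) (r ^ (k + 1)) t‖ < lam⁻¹ := by rwa [norm_loop _ (by positivity)]
  have h1 := Complex.slitPlane_ne_zero (one_sub_mem_slitPlane hlam hx)
  have h2 := Complex.slitPlane_ne_zero (mul_sub_mem_slitPlane hlam hx)
  have hk : (k + 1 : ℂ) ≠ 0 := by exact_mod_cast k.succ_ne_zero
  rw [branch, mul_pow, loop_pow, mul_one, ← Complex.exp_nat_mul]
  congr 1
  rw [← Complex.exp_log h1, ← Complex.exp_log h2, ← Complex.exp_sub, ← Complex.exp_nat_mul,
    Complex.exp_log h1, Complex.exp_log h2]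
  congr 1
  push_cast
  field_simp

theorem hasDerivAt_branch (hlam : 1 < lam) (hr : 0 < r) (hr1 : r ^ (k + 1) < lam⁻¹) (t : ℝ) :
    HasDerivAt (branch k lam r) (2 * Real.pi * (k + 1 : ℕ) * Complex.I *
      ((∑' n, logDerivCoeff k lam n * loop (k + 1) (r ^ (k + 1)) t ^ n) * branch k lam r t)) t := by
  have hx : ‖loop (k + 1) (r ^ (k + 1)) t‖ < lam⁻¹ := by rwa [norm_loop _ (by positivity)]
  rw [(hasSum_logDerivCoeff k hlam hx).tsum_eq]
  have m1 := one_sub_mem_slitPlane hlam hx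
  have m2 := mul_sub_mem_slitPlane hlam hx
  have n1 := Complex.slitPlane_ne_zero m1
  have n2 := right_ne_zero_of_mul (Complex.slitPlane_ne_zero m2)
  have hl : (lam : ℂ) ≠ 0 := by exact_mod_cast (by linarith : lam ≠ 0)
  have hk : (k + 1 : ℂ) ≠ 0 := by exact_mod_cast k.succ_ne_zero
  have hd := hasDerivAt_loop (k + 1) (r ^ (k + 1)) t
  have d1 := ((hd.const_mul (lam : ℂ)).const_sub 1).clog_real m1
  have d2 := ((hd.const_sub (lam : ℂ)).const_mul (lam : ℂ)).clog_real m2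
  have d3 := ((d1.sub d2).const_mul (k / (k + 1) : ℂ)).cexp
  refine ((hasDerivAt_loop 1 r t).mul d3).congr_deriv ?_
  have n3 : (1 - (lam : ℂ)⁻¹ * loop (k + 1) (r ^ (k + 1)) t) =
      (lam - loop (k + 1) (r ^ (k + 1)) t) / lam := by field_simp
  rw [n3, branch]
  simp only [Pi.sub_apply]
  set x := loop (k + 1) (r ^ (k + 1)) t
  set E := Complex.exp (k / (k + 1) * (Complex.log (1 - lam * x) - Complex.log (lam * (lam - x))))
  push_cast
  field_simp
  ring

end

/-- The function `∑ (m + n) ^ i a_n z ^ n` on the circle `|z| = R`, where `a_n` are the Frobenius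
coefficients: `z ^ m` times it is `(z d/dz) ^ i` of the Frobenius solution. -/
noncomputable def frobeniusSum (k : ℕ) (lam : ℝ) (m d : ℂ) (R : ℝ) (i : ℕ) (t : ℝ) : ℂ :=
  ∑' n : ℕ, ((m + n) ^ i * frobeniusCoeff (logDerivCoeff k lam) m d n) * loop (k + 1) R t ^ n

section

variable {k : ℕ} {lam R : ℝ} (hlam : 1 < lam) (hR : 0 ≤ R) (hR1 : R < lam⁻¹)
include hlam hR hR1

theorem summable_frobeniusSum (m d : ℂ) (i l : ℕ) :
    Summable fun n : ℕ => (n : ℝ) ^ l *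
      (‖(m + n) ^ i * frobeniusCoeff (logDerivCoeff k lam) m d n‖ * R ^ n) := by
  have hl : 0 < lam := by linarith
  have hRL : R * lam < 1 := by
    calc R * lam < lam⁻¹ * lam := by gcongr
      _ = 1 := inv_mul_cancel₀ hl.ne'
  have base := summable_frobeniusCoeff m d hl zero_le_one (norm_logDerivCoeff_le k hlam) hR hRL
  induction i generalizing l with
  | zero => simpa using base l
  | succ i ih =>
    refine Summable.of_nonneg_of_le (fun n => by positivity) (fun n => ?_)
      (((ih l).mul_left ‖m‖).add (ih (l + 1)))
    have h : ‖m + (n : ℂ)‖ ≤ ‖m‖ + n := by simpa using norm_add_le m (n : ℂ)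
    rw [pow_succ' (m + (n : ℂ)), mul_assoc, norm_mul]
    calc _ ≤ (n : ℝ) ^ l * ((‖m‖ + n) *
          ‖(m + n) ^ i * frobeniusCoeff (logDerivCoeff k lam) m d n‖ * R ^ n) := by gcongr
      _ = _ := by ring

theorem summable_norm_frobeniusSum (m d : ℂ) (i : ℕ) (t : ℝ) :
    Summable fun n : ℕ => ‖((m + n) ^ i * frobeniusCoeff (logDerivCoeff k lam) m d n) *
      loop (k + 1) R t ^ n‖ := by
  simpa [norm_loop _ hR] using summable_frobeniusSum (k := k) hlam hR hR1 m d i 0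

theorem hasDerivAt_exp_mul_frobeniusSum (m d : ℂ) (i : ℕ) (t : ℝ) :
    HasDerivAt (fun t : ℝ => Complex.exp (2 * Real.pi * (k + 1 : ℕ) * Complex.I * m * t) *
        frobeniusSum k lam m d R i t)
      (2 * Real.pi * (k + 1 : ℕ) * Complex.I *
        (Complex.exp (2 * Real.pi * (k + 1 : ℕ) * Complex.I * m * t) *
          frobeniusSum k lam m d R (i + 1) t)) t := by
  have h1 : HasDerivAt
      (fun t : ℝ => Complex.exp (2 * Real.pi * (k + 1 : ℕ) * Complex.I * m * t)) _ t :=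
    ((Complex.ofRealCLM.hasDerivAt (x := t)).const_mul
      (2 * Real.pi * (k + 1 : ℕ) * Complex.I * m)).cexp
  have s0 := summable_frobeniusSum (k := k) hlam hR hR1 m d i 0
  have s1 := summable_frobeniusSum (k := k) hlam hR hR1 m d i 1
  simp only [pow_zero, one_mul] at s0
  simp only [pow_one] at s1
  have h2 := hasDerivAt_tsum_loop (k + 1) hR s0 s1 t
  refine (h1.mul h2).congr_deriv ?_
  have e : frobeniusSum k lam m d R (i + 1) t = m * frobeniusSum k lam m d R i t +
      ∑' n : ℕ, (n * ((m + n) ^ i * frobeniusCoeff (logDerivCoeff k lam) m d n)) *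
        loop (k + 1) R t ^ n := by
    rw [frobeniusSum, frobeniusSum, ← tsum_mul_left, ← Summable.tsum_add]
    · refine tsum_congr fun n => ?_
      ring
    · exact (summable_norm_frobeniusSum hlam hR hR1 m d i t).of_norm.mul_left m
    · refine Summable.of_norm ?_
      simpa [norm_loop _ hR, mul_assoc] using summable_frobeniusSum (k := k) hlam hR hR1 m d i 1
  rw [e, ← frobeniusSum]
  simp only [Complex.ofRealCLM_apply]
  push_cast
  ring

theorem frobeniusSum_ode {m d : ℂ} (hm : m ^ 2 + logDerivCoeff k lam 0 * (m + d) = 0)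
    (hn : ∀ n : ℕ, 1 ≤ n → (n + 2 * m + logDerivCoeff k lam 0 : ℂ) ≠ 0) (t : ℝ) :
    frobeniusSum k lam m d R 2 t = -((∑' n, logDerivCoeff k lam n * loop (k + 1) R t ^ n) *
      (frobeniusSum k lam m d R 1 t + d * frobeniusSum k lam m d R 0 t)) := by
  have hs := summable_norm_frobeniusSum (k := k) hlam hR hR1 m d
  have e1 : frobeniusSum k lam m d R 1 t + d * frobeniusSum k lam m d R 0 t =
      ∑' n : ℕ, ((m + n + d) * frobeniusCoeff (logDerivCoeff k lam) m d n) *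
        loop (k + 1) R t ^ n := by
    rw [frobeniusSum, frobeniusSum, ← tsum_mul_left, ← Summable.tsum_add (hs 1 t).of_norm
      ((hs 0 t).of_norm.mul_left d)]
    refine tsum_congr fun n => ?_
    ring
  have s1 : Summable fun n : ℕ => ‖((m + n + d) * frobeniusCoeff (logDerivCoeff k lam) m d n) *
        loop (k + 1) R t ^ n‖ := by
    refine Summable.of_nonneg_of_le (fun n => norm_nonneg _) (fun n => ?_)
      ((hs 1 t).add ((hs 0 t).mul_left ‖d‖))
    rw [← norm_mul]
    refine le_trans (le_of_eq ?_) (norm_add_le _ _)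
    congr 1
    ring
  have s2 : Summable fun n : ℕ => ‖logDerivCoeff k lam n * loop (k + 1) R t ^ n‖ := by
    have hl : 0 < lam := by linarith
    have hRL : ‖R * lam‖ < 1 := by
      rw [Real.norm_of_nonneg (by positivity)]
      calc R * lam < lam⁻¹ * lam := by gcongr
        _ = 1 := inv_mul_cancel₀ hl.ne'
    refine Summable.of_nonneg_of_le (fun n => norm_nonneg _) (fun n => ?_)
      (summable_geometric_of_norm_lt_one hRL)
    rw [norm_mul, norm_pow, norm_loop _ hR, mul_pow, mul_comm (R ^ n)]
    gcongr
    simpa using norm_logDerivCoeff_le k hlam n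
  rw [e1, tsum_mul_tsum_eq_tsum_sum_antidiagonal_of_summable_norm s2 s1, ← tsum_neg, frobeniusSum]
  refine tsum_congr fun n => ?_
  have h := frobeniusCoeff_recursion hm hn n
  rw [eq_neg_iff_add_eq_zero, ← zero_mul (loop (k + 1) R t ^ n), ← h, add_mul, Finset.sum_mul]
  congr 1
  refine Finset.sum_congr rfl fun p hp => ?_
  rw [← Finset.HasAntidiagonal.mem_antidiagonal.1 hp, pow_add]
  ring

/-- The Frobenius series for two different exponents are independent: the mean value over the
circle of the expression below is the difference `m - m'` of the exponents. -/
theorem exists_wronskian_ne_zero {m m' : ℂ} (d : ℂ) (hmm : m ≠ m') :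
    ∃ t, frobeniusSum k lam m d R 1 t * frobeniusSum k lam m' d R 0 t -
      frobeniusSum k lam m d R 0 t * frobeniusSum k lam m' d R 1 t ≠ 0 := by
  by_contra! h
  set a : ℕ → ℕ → ℂ := fun i n => (m + n) ^ i * frobeniusCoeff (logDerivCoeff k lam) m d n
  set a' : ℕ → ℕ → ℂ := fun i n => (m' + n) ^ i * frobeniusCoeff (logDerivCoeff k lam) m' d n
  have hs : ∀ i t, Summable fun n => ‖a i n * loop (k + 1) R t ^ n‖ :=
    fun i t => summable_norm_frobeniusSum hlam hR hR1 m d i t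
  have hs' : ∀ i t, Summable fun n => ‖a' i n * loop (k + 1) R t ^ n‖ :=
    fun i t => summable_norm_frobeniusSum hlam hR hR1 m' d i t
  set b : ℕ → ℂ := fun n => ∑ p ∈ Finset.HasAntidiagonal.antidiagonal n,
    (a 1 p.1 * a' 0 p.2 - a 0 p.1 * a' 1 p.2)
  have hb : ∀ n t, b n * loop (k + 1) R t ^ n = ∑ p ∈ Finset.HasAntidiagonal.antidiagonal n,
        (a 1 p.1 * loop (k + 1) R t ^ p.1) * (a' 0 p.2 * loop (k + 1) R t ^ p.2) -
      ∑ p ∈ Finset.HasAntidiagonal.antidiagonal n,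
        (a 0 p.1 * loop (k + 1) R t ^ p.1) * (a' 1 p.2 * loop (k + 1) R t ^ p.2) := by
    intro n t
    rw [← Finset.sum_sub_distrib, Finset.sum_mul]
    refine Finset.sum_congr rfl fun p hp => ?_
    rw [← Finset.HasAntidiagonal.mem_antidiagonal.1 hp, pow_add]
    ring
  have c1 := fun t => summable_norm_sum_mul_antidiagonal_of_summable_norm (hs 1 t) (hs' 0 t)
  have c2 := fun t => summable_norm_sum_mul_antidiagonal_of_summable_norm (hs 0 t) (hs' 1 t)
  have hsb : Summable fun n => ‖b n‖ * R ^ n := by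
    refine Summable.of_nonneg_of_le (fun n => by positivity) (fun n => ?_) ((c1 0).add (c2 0))
    refine le_trans (le_of_eq ?_) (norm_sub_le _ _)
    rw [← hb, norm_mul, norm_pow, norm_loop _ hR]
  have h0 : b 0 = 0 := by
    refine eq_zero_of_tsum_loop_eq_zero k.succ_ne_zero hR hsb fun t => ?_
    rw [← h t]
    simp only [hb]
    rw [Summable.tsum_sub (c1 t).of_norm (c2 t).of_norm,
      ← tsum_mul_tsum_eq_tsum_sum_antidiagonal_of_summable_norm (hs 1 t) (hs' 0 t),
      ← tsum_mul_tsum_eq_tsum_sum_antidiagonal_of_summable_norm (hs 0 t) (hs' 1 t)]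
    rfl
  simp [b, a, a', frobeniusCoeff_zero] at h0
  exact hmm (sub_eq_zero.1 h0)

end

/-! ### Solutions along the circle and their monodromy -/

/-- Abel's identity for two solutions of a traceless linear system `f₁' = a f₁ + b f₂`,
`f₂' = e f₁ - a f₂` on an interval: their Wronskian is constant. -/
theorem wronskian_eq {x y : ℝ} (hxy : x ≤ y) {a b e f₁ f₂ g₁ g₂ : ℝ → ℂ}
    (hf₁ : ∀ t ∈ Set.Icc x y, HasDerivWithinAt f₁ (a t * f₁ t + b t * f₂ t) (Set.Icc x y) t)
    (hf₂ : ∀ t ∈ Set.Icc x y, HasDerivWithinAt f₂ (e t * f₁ t - a t * f₂ t) (Set.Icc x y) t)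
    (hg₁ : ∀ t ∈ Set.Icc x y, HasDerivWithinAt g₁ (a t * g₁ t + b t * g₂ t) (Set.Icc x y) t)
    (hg₂ : ∀ t ∈ Set.Icc x y, HasDerivWithinAt g₂ (e t * g₁ t - a t * g₂ t) (Set.Icc x y) t) :
    f₁ y * g₂ y - f₂ y * g₁ y = f₁ x * g₂ x - f₂ x * g₁ x := by
  have hd : ∀ t ∈ Set.Icc x y,
      HasDerivWithinAt (fun t => f₁ t * g₂ t - f₂ t * g₁ t) 0 (Set.Icc x y) t := by
    intro t ht
    refine (((hf₁ t ht).mul (hg₂ t ht)).sub ((hf₂ t ht).mul (hg₁ t ht))).congr_deriv ?_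
    ring
  refine constant_of_derivWithin_zero (f := fun t => f₁ t * g₂ t - f₂ t * g₁ t)
    (fun t ht => (hd t ht).differentiableWithinAt) (fun t ht => ?_) y ⟨hxy, le_rfl⟩
  have hlt : x < y := ht.1.trans_lt ht.2
  exact (hd t ⟨ht.1, ht.2.le⟩).derivWithin (uniqueDiffOn_Icc hlt t ⟨ht.1, ht.2.le⟩)

/-- The second entry of the solution of `dF F⁻¹ = [[G, -G²], [1, -G]] Ω` with Frobenius
exponent `m` along the circle. -/
noncomputable def solutionBot (k : ℕ) (lam c r : ℝ) (m : ℂ) (t : ℝ) : ℂ :=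
  Complex.exp (2 * Real.pi * (k + 1 : ℕ) * Complex.I * m * t) *
    frobeniusSum k lam m (scale k lam * c) (r ^ (k + 1)) 0 t

/-- The first entry of the solution whose second entry is `solutionBot`, on the branch
`w = η * branch` of the curve. -/
noncomputable def solutionTop (k : ℕ) (lam c r : ℝ) (η m : ℂ) (t : ℝ) : ℂ :=
  η * branch k lam r t * (Complex.exp (2 * Real.pi * (k + 1 : ℕ) * Complex.I * m * t) *
      frobeniusSum k lam m (scale k lam * c) (r ^ (k + 1)) 1 t / c +
    scale k lam * solutionBot k lam c r m t)

section

variable {k : ℕ} {lam c r : ℝ}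

theorem frobeniusSum_one (m d : ℂ) (R : ℝ) (i : ℕ) :
    frobeniusSum k lam m d R i 1 = frobeniusSum k lam m d R i 0 := by
  simp only [frobeniusSum, loop_one, loop_zero]

theorem solutionBot_one (m : ℂ) : solutionBot k lam c r m 1 =
    Complex.exp (2 * Real.pi * (k + 1 : ℕ) * Complex.I * m) * solutionBot k lam c r m 0 := by
  simp [solutionBot, frobeniusSum_one]

theorem solutionTop_one (η m : ℂ) : solutionTop k lam c r η m 1 =
    Complex.exp (2 * Real.pi * (k + 1 : ℕ) * Complex.I * m) * solutionTop k lam c r η m 0 := by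
  rw [solutionTop, solutionTop, solutionBot_one, branch_one, frobeniusSum_one]
  simp only [Complex.ofReal_one, Complex.ofReal_zero, mul_one, mul_zero, Complex.exp_zero]
  ring

variable (hlam : 1 < lam) (hc : c ≠ 0) (hr : 0 < r) (hr1 : r ^ (k + 1) < lam⁻¹)
  {η : ℂ} (hη : η ≠ 0)
include hlam hc hr hr1 hη

theorem hasDerivAt_solutionBot (m : ℂ) (t : ℝ) :
    HasDerivAt (solutionBot k lam c r m)
      (2 * Real.pi * (k + 1 : ℕ) * Complex.I * c / (η * branch k lam r t) *
          solutionTop k lam c r η m t -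
        2 * Real.pi * (k + 1 : ℕ) * Complex.I * c * scale k lam * solutionBot k lam c r m t) t := by
  refine (hasDerivAt_exp_mul_frobeniusSum (k := k) hlam (by positivity) hr1 m (scale k lam * c) 0
    t).congr_deriv ?_
  have hb := branch_ne_zero k lam hr t
  have hcc : (c : ℂ) ≠ 0 := by exact_mod_cast hc
  rw [solutionTop]
  field_simp
  ring

theorem hasDerivAt_solutionTop {m : ℂ}
    (hm : m ^ 2 + logDerivCoeff k lam 0 * (m + scale k lam * c) = 0)
    (hn : ∀ n : ℕ, 1 ≤ n → (n + 2 * m + logDerivCoeff k lam 0 : ℂ) ≠ 0) (t : ℝ) :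
    HasDerivAt (solutionTop k lam c r η m)
      (2 * Real.pi * (k + 1 : ℕ) * Complex.I * c * scale k lam * solutionTop k lam c r η m t +
        -(2 * Real.pi * (k + 1 : ℕ) * Complex.I * c * scale k lam ^ 2 * (η * branch k lam r t)) *
          solutionBot k lam c r m t) t := by
  have hR : 0 ≤ r ^ (k + 1) := by positivity
  have hcc : (c : ℂ) ≠ 0 := by exact_mod_cast hc
  have h1 := ((hasDerivAt_branch (k := k) hlam hr hr1 t).const_mul η)
  have h2 := (hasDerivAt_exp_mul_frobeniusSum (k := k) hlam hR hr1 m (scale k lam * c) 1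
    t).div_const (c : ℂ)
  have h3 := (hasDerivAt_exp_mul_frobeniusSum (k := k) hlam hR hr1 m (scale k lam * c) 0
    t).const_mul (scale k lam : ℂ)
  refine (h1.mul (h2.add h3)).congr_deriv ?_
  rw [frobeniusSum_ode hlam hR hr1 hm hn t, solutionTop, solutionBot]
  simp only [Pi.add_apply]
  field_simp
  ring

/-- The monodromy of a solution `Φ` along the circle is similar to the diagonal matrix
`exp (- 2 π i (k + 1) m), exp (- 2 π i (k + 1) m')`, where `m ≠ m'` are the two exponents: the rows
of `L` consist of the constant Wronskians of the Frobenius solutions with the columns of `Φ`. -/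
theorem exists_monodromy_diagonal {m m' : ℂ} (hmm : m ≠ m')
    (hm : m ^ 2 + logDerivCoeff k lam 0 * (m + scale k lam * c) = 0)
    (hn : ∀ n : ℕ, 1 ≤ n → (n + 2 * m + logDerivCoeff k lam 0 : ℂ) ≠ 0)
    (hm' : m' ^ 2 + logDerivCoeff k lam 0 * (m' + scale k lam * c) = 0)
    (hn' : ∀ n : ℕ, 1 ≤ n → (n + 2 * m' + logDerivCoeff k lam 0 : ℂ) ≠ 0)
    {Φ : ℝ → Matrix (Fin 2) (Fin 2) ℂ}
    (hΦ₀ : ∀ j, ∀ t ∈ Set.Icc (0 : ℝ) 1, HasDerivWithinAt (fun t => Φ t 0 j)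
      (2 * Real.pi * (k + 1 : ℕ) * Complex.I * c * scale k lam * Φ t 0 j +
        -(2 * Real.pi * (k + 1 : ℕ) * Complex.I * c * scale k lam ^ 2 * (η * branch k lam r t)) *
          Φ t 1 j) (Set.Icc 0 1) t)
    (hΦ₁ : ∀ j, ∀ t ∈ Set.Icc (0 : ℝ) 1, HasDerivWithinAt (fun t => Φ t 1 j)
      (2 * Real.pi * (k + 1 : ℕ) * Complex.I * c / (η * branch k lam r t) * Φ t 0 j -
        2 * Real.pi * (k + 1 : ℕ) * Complex.I * c * scale k lam * Φ t 1 j) (Set.Icc 0 1) t)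
    (hdet : (Φ 0).det ≠ 0) {ρ : Matrix (Fin 2) (Fin 2) ℂ} (hρ : Φ 1 = Φ 0 * ρ) :
    ∃ L : Matrix (Fin 2) (Fin 2) ℂ, L.det ≠ 0 ∧
      L * ρ = Matrix.diagonal ![Complex.exp (-(2 * Real.pi * (k + 1 : ℕ) * Complex.I * m)),
        Complex.exp (-(2 * Real.pi * (k + 1 : ℕ) * Complex.I * m'))] * L := by
  have hR : 0 ≤ r ^ (k + 1) := by positivity
  have hcc : (c : ℂ) ≠ 0 := by exact_mod_cast hc
  -- the Frobenius solutions are independent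
  have hW : solutionTop k lam c r η m 0 * solutionBot k lam c r m' 0 -
      solutionBot k lam c r m 0 * solutionTop k lam c r η m' 0 ≠ 0 := by
    obtain ⟨t, ht⟩ := exists_wronskian_ne_zero (k := k) hlam hR hr1 (scale k lam * c) hmm
    have h1 : solutionTop k lam c r η m t * solutionBot k lam c r m' t -
        solutionBot k lam c r m t * solutionTop k lam c r η m' t ≠ 0 := by
      have e : solutionTop k lam c r η m t * solutionBot k lam c r m' t -
        solutionBot k lam c r m t * solutionTop k lam c r η m' t = η * branch k lam r t / c *
          Complex.exp (2 * Real.pi * (k + 1 : ℕ) * Complex.I * m * t) *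
          Complex.exp (2 * Real.pi * (k + 1 : ℕ) * Complex.I * m' * t) *
          (frobeniusSum k lam m (scale k lam * c) (r ^ (k + 1)) 1 t *
            frobeniusSum k lam m' (scale k lam * c) (r ^ (k + 1)) 0 t -
          frobeniusSum k lam m (scale k lam * c) (r ^ (k + 1)) 0 t *
            frobeniusSum k lam m' (scale k lam * c) (r ^ (k + 1)) 1 t) := by
        rw [solutionTop, solutionTop, solutionBot, solutionBot]
        ring
      rw [e]
      have := branch_ne_zero k lam hr t
      have := Complex.exp_ne_zero (2 * Real.pi * (k + 1 : ℕ) * Complex.I * m * t)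
      have := Complex.exp_ne_zero (2 * Real.pi * (k + 1 : ℕ) * Complex.I * m' * t)
      positivity
    have hd : ∀ {p : ℂ}, p ^ 2 + logDerivCoeff k lam 0 * (p + scale k lam * c) = 0 →
        (∀ n : ℕ, 1 ≤ n → (n + 2 * p + logDerivCoeff k lam 0 : ℂ) ≠ 0) → _ :=
      fun hp hnp => hasDerivAt_solutionTop hlam hc hr hr1 hη hp hnp
    have hb := hasDerivAt_solutionBot (k := k) hlam hc hr hr1 hη
    rcases le_total 0 t with h | h
    · rwa [wronskian_eq h (fun s _ => (hd hm hn s).hasDerivWithinAt)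
        (fun s _ => (hb m s).hasDerivWithinAt) (fun s _ => (hd hm' hn' s).hasDerivWithinAt)
        (fun s _ => (hb m' s).hasDerivWithinAt)] at h1
    · rwa [← wronskian_eq h (fun s _ => (hd hm hn s).hasDerivWithinAt)
        (fun s _ => (hb m s).hasDerivWithinAt) (fun s _ => (hd hm' hn' s).hasDerivWithinAt)
        (fun s _ => (hb m' s).hasDerivWithinAt)] at h1
  have key : ∀ {p : ℂ}, p ^ 2 + logDerivCoeff k lam 0 * (p + scale k lam * c) = 0 →
      (∀ n : ℕ, 1 ≤ n → (n + 2 * p + logDerivCoeff k lam 0 : ℂ) ≠ 0) → ∀ j,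
      solutionTop k lam c r η p 0 * (Φ 0 * ρ) 1 j - solutionBot k lam c r p 0 * (Φ 0 * ρ) 0 j =
      Complex.exp (-(2 * Real.pi * (k + 1 : ℕ) * Complex.I * p)) *
        (solutionTop k lam c r η p 0 * Φ 0 1 j - solutionBot k lam c r p 0 * Φ 0 0 j) := by
    intro p hp hnp j
    have h := wronskian_eq zero_le_one
      (fun s _ => (hasDerivAt_solutionTop hlam hc hr hr1 hη hp hnp s).hasDerivWithinAt)
      (fun s _ => (hasDerivAt_solutionBot hlam hc hr hr1 hη p s).hasDerivWithinAt)
      (hΦ₀ j) (hΦ₁ j)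
    rw [← h, solutionTop_one, solutionBot_one, hρ, Complex.exp_neg]
    have := Complex.exp_ne_zero (2 * Real.pi * (k + 1 : ℕ) * Complex.I * p)
    field_simp
  set A : Matrix (Fin 2) (Fin 2) ℂ :=
    !![-solutionBot k lam c r m 0, solutionTop k lam c r η m 0;
      -solutionBot k lam c r m' 0, solutionTop k lam c r η m' 0]
  refine ⟨A * Φ 0, ?_, ?_⟩
  · rw [Matrix.det_mul]
    refine mul_ne_zero ?_ hdet
    rw [Matrix.det_fin_two_of]
    intro h0
    apply hW
    linear_combination h0
  · rw [Matrix.mul_assoc]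
    ext i j
    rw [Matrix.diagonal_mul]
    have k1 := key hm hn j
    have k2 := key hm' hn' j
    fin_cases i
    · simp only [A, Matrix.mul_apply (M := !![_, _; _, _]), Fin.sum_univ_two]
      simp only [Fin.zero_eta, Matrix.of_apply, Matrix.cons_val', Matrix.cons_val_zero,
        Matrix.cons_val_one, Matrix.cons_val_fin_one]
      linear_combination k1
    · simp only [A, Matrix.mul_apply (M := !![_, _; _, _]), Fin.sum_univ_two]
      simp only [Fin.mk_one, Matrix.of_apply, Matrix.cons_val', Matrix.cons_val_zero,
        Matrix.cons_val_one, Matrix.cons_val_fin_one]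
      linear_combination k2

end

/-! ### Circles around the ends and their lifts -/

theorem scale_pos (k : ℕ) {lam : ℝ} (hlam : 1 < lam) : 0 < scale k lam :=
  Real.rpow_pos_of_pos (by linarith) _

theorem scale_pow (k : ℕ) {lam : ℝ} (hlam : 1 < lam) : scale k lam ^ (k + 1) = lam ^ k := by
  rw [scale, ← Real.rpow_natCast, ← Real.rpow_mul (by linarith), ← Real.rpow_natCast]
  congr 1
  push_cast
  field_simp

theorem loop_one_eq (r t : ℝ) :
    loop 1 r t = r * Complex.exp (2 * Real.pi * (t : ℝ) * Complex.I) := by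
  simp [loop]

theorem exists_snd_eq_coe {k : ℕ} {lam : ℝ} (p : curve k lam) {z : ℂ}
    (hz : p.1.1 = (z : OnePoint ℂ)) (hzl : z ≠ lam) :
    ∃ w : ℂ, p.1.2 = (w : OnePoint ℂ) ∧
      w ^ (k + 1) = z * ((z - (lam : ℂ)⁻¹) / ((lam : ℂ) - z)) ^ k := by
  rcases p.2.1 with ⟨z', w, hp, -, hw⟩ | hp | hp
  · rw [hp] at hz
    obtain rfl : z' = z := OnePoint.coe_injective hz
    exact ⟨w, by rw [hp], hw⟩
  · rw [hp] at hz
    exact absurd (OnePoint.coe_injective hz).symm hzl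
  · rw [Set.mem_singleton_iff.1 hp] at hz
    exact absurd hz (OnePoint.infty_ne_coe z)

/-- A continuous function on an interval with constant `n`-th power is constant. -/
theorem eq_of_pow_eq {n : ℕ} (hn : 0 < n) {g : unitInterval → ℂ} (hg : Continuous g) {C : ℂ}
    (h : ∀ t, g t ^ n = C) (s t : unitInterval) : g s = g t := by
  have hT : IsDiscrete {x : ℂ | x ^ n = C} := by
    refine (Set.Finite.subset (Polynomial.nthRoots n C).toFinset.finite_toSet ?_).isDiscrete
    intro x hx
    simpa [Polynomial.mem_nthRoots hn] using hx
  exact isPreconnected_univ.constant_of_mapsTo hT hg.continuousOn (fun t _ => h t)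
    (Set.mem_univ s) (Set.mem_univ t)

/-- The function `w` on the curve near the end `e`, in terms of a value `b` of `w` near `(0, 0)`:
`b` itself at `(0, 0)`; the involution `(z, w) ↦ (1 / z, 1 / (s² w))`,
`s = scale k lam`, carries it to the end `(∞, ∞)`. -/
noncomputable def End.w (k : ℕ) (lam : ℝ) : End → ℂ → ℂ
  | .zero, b => b
  | .infinity, b => ((scale k lam : ℂ) ^ 2 * b)⁻¹

section

variable {k : ℕ} {lam r : ℝ} (hlam : 1 < lam) (hr : 0 < r) (hr1 : r ^ (k + 1) < lam⁻¹)

include hr in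
theorem End.z_loop_ne_zero (e : End) (t : ℝ) : e.z k (loop 1 r t) ≠ 0 := by
  have h : loop 1 r t ≠ 0 := by
    rw [← norm_ne_zero_iff, norm_loop 1 hr.le]
    exact hr.ne'
  cases e
  · exact pow_ne_zero _ h
  · exact inv_ne_zero (pow_ne_zero _ h)

theorem End.continuous_w (e : End) {X : Type*} [TopologicalSpace X] {b : X → ℂ}
    (hb : Continuous b) (hlam : 1 < lam) (h0 : ∀ x, b x ≠ 0) :
    Continuous fun x => e.w k lam (b x) := by
  cases e
  · exact hb
  · refine (continuous_const.mul hb).inv₀ fun x => mul_ne_zero ?_ (h0 x)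
    exact pow_ne_zero _ (by exact_mod_cast (scale_pos k hlam).ne')

include hlam hr hr1

theorem End.z_loop_ne (e : End) (t : ℝ) :
    e.z k (loop 1 r t) ≠ lam ∧ e.z k (loop 1 r t) ≠ (lam : ℂ)⁻¹ := by
  have hl : 0 < lam := by linarith
  have hl1 : lam⁻¹ < 1 := inv_lt_one_of_one_lt₀ hlam
  have hn : ‖loop 1 r t ^ (k + 1)‖ = r ^ (k + 1) := by rw [norm_pow, norm_loop 1 hr.le]
  cases e
  · constructor <;> intro h <;> have h' : loop 1 r t ^ (k + 1) = _ := h <;> rw [h'] at hn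
    · rw [Complex.norm_real, Real.norm_of_nonneg hl.le] at hn
      linarith
    · rw [norm_inv, Complex.norm_real, Real.norm_of_nonneg hl.le] at hn
      linarith
  · constructor <;> intro h <;> have h' : (loop 1 r t ^ (k + 1))⁻¹ = _ := h <;>
      rw [inv_eq_iff_eq_inv] at h' <;> rw [h'] at hn
    · rw [norm_inv, Complex.norm_real, Real.norm_of_nonneg hl.le] at hn
      linarith
    · rw [inv_inv, Complex.norm_real, Real.norm_of_nonneg hl.le] at hn
      linarith

/-- Over the circle at the end `e`, the equation of the curve says that `w = e.w (η * branch)` with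
`η ^ (k + 1) = (-1) ^ k`. -/
theorem End.w_branch_pow_iff (e : End) (t : ℝ) {η : ℂ} (hη : η ≠ 0) :
    e.w k lam (η * branch k lam r t) ^ (k + 1) = e.z k (loop 1 r t) *
      ((e.z k (loop 1 r t) - (lam : ℂ)⁻¹) / ((lam : ℂ) - e.z k (loop 1 r t))) ^ k ↔
    η ^ (k + 1) = (-1) ^ k := by
  have hl : (lam : ℂ) ≠ 0 := by exact_mod_cast (by linarith : lam ≠ 0)
  have hs : (scale k lam : ℂ) ^ (k + 1) = lam ^ k := by exact_mod_cast scale_pow k hlam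
  have hs0 : (scale k lam : ℂ) ≠ 0 := by exact_mod_cast (scale_pos k hlam).ne'
  have hB := branch_pow hlam hr hr1 t
  have hx0 : loop (k + 1) (r ^ (k + 1)) t ≠ 0 := by
    rw [← norm_ne_zero_iff, norm_loop _ (by positivity)]
    positivity
  have hx : ‖loop (k + 1) (r ^ (k + 1)) t‖ < lam⁻¹ := by rwa [norm_loop _ (by positivity)]
  have n1 := Complex.slitPlane_ne_zero (one_sub_mem_slitPlane hlam hx)
  have n2 := right_ne_zero_of_mul (Complex.slitPlane_ne_zero (mul_sub_mem_slitPlane hlam hx))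
  have hb0 := branch_ne_zero k lam hr t
  have hz : loop 1 r t ^ (k + 1) = loop (k + 1) (r ^ (k + 1)) t := by rw [loop_pow, mul_one]
  set x := loop (k + 1) (r ^ (k + 1)) t
  set b := branch k lam r t
  have hbp : b ^ (k + 1) ≠ 0 := pow_ne_zero _ hb0
  have hηp : η ^ (k + 1) ≠ 0 := pow_ne_zero _ hη
  cases e
  · simp only [End.w, End.z, hz]
    have e1 : x * ((x - (lam : ℂ)⁻¹) / (lam - x)) ^ k = (-1) ^ k * b ^ (k + 1) := by
      rw [hB, mul_left_comm, ← mul_pow]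
      congr 2
      field_simp
      ring
    rw [e1, mul_pow]
    exact mul_left_inj' hbp
  · simp only [End.w, End.z, hz]
    have n3 : (lam : ℂ) - x⁻¹ = -((1 - lam * x) / x) := by field_simp; ring
    have e1 : x⁻¹ * ((x⁻¹ - (lam : ℂ)⁻¹) / (lam - x⁻¹)) ^ k * (lam ^ k * lam ^ k * b ^ (k + 1)) =
        (-1) ^ k := by
      rw [hB, show x⁻¹ * ((x⁻¹ - (lam : ℂ)⁻¹) / (lam - x⁻¹)) ^ k * (lam ^ k * lam ^ k *
          (x * ((1 - lam * x) / (lam * (lam - x))) ^ k)) = (x⁻¹ * x) *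
          ((x⁻¹ - (lam : ℂ)⁻¹) / (lam - x⁻¹) * lam * lam * ((1 - lam * x) / (lam * (lam - x)))) ^ k
          by simp only [mul_pow]; ring, inv_mul_cancel₀ hx0, one_mul]
      congr 1
      rw [n3]
      field_simp
      rw [div_self (by rwa [mul_comm x])]
    have e2 : (((scale k lam : ℂ) ^ 2 * (η * b))⁻¹) ^ (k + 1) * (lam ^ k * lam ^ k * b ^ (k + 1)) =
        (η ^ (k + 1))⁻¹ := by
      rw [← hs, inv_pow]
      simp only [mul_pow]
      field_simp
      ring
    have hne : (lam : ℂ) ^ k * lam ^ k * b ^ (k + 1) ≠ 0 :=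
      mul_ne_zero (mul_ne_zero (pow_ne_zero _ hl) (pow_ne_zero _ hl)) hbp
    rw [← mul_left_inj' hne, e1, e2, inv_eq_iff_eq_inv, ← inv_pow, inv_neg_one]

theorem continuous_branch : Continuous (branch k lam r) :=
  continuous_iff_continuousAt.2 fun t => (hasDerivAt_branch hlam hr hr1 t).continuousAt

end

namespace Face

variable {k : ℕ} {lam c : ℝ}

theorem IsLiftedCircle.exists_branch (hlam : 1 < lam) {S : Face.{u} k lam c} {e : End}
    {σ : unitInterval → S.X} (hσ : Continuous σ) {r : ℝ} (hr : 0 < r) (hr1 : r ^ (k + 1) < lam⁻¹)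
    (hz : ∀ t : unitInterval, (S.π (σ t)).1.1 = ((e.z k (loop 1 r t) : ℂ) : OnePoint ℂ)) :
    ∃ η : ℂ, η ≠ 0 ∧ ∀ t : unitInterval,
      (S.π (σ t)).1.2 = ((e.w k lam (η * branch k lam r t) : ℂ) : OnePoint ℂ) := by
  have hs0 : (scale k lam : ℂ) ≠ 0 := by exact_mod_cast (scale_pos k hlam).ne'
  choose w hw hwp using fun t : unitInterval =>
    exists_snd_eq_coe (S.π (σ t)) (hz t) (e.z_loop_ne hlam hr hr1 t).1
  have hb0 := branch_ne_zero k lam hr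
  have hwc : Continuous w := by
    rw [OnePoint.isOpenEmbedding_coe.isInducing.continuous_iff]
    have : ((↑) : ℂ → OnePoint ℂ) ∘ w = fun t => (S.π (σ t)).1.2 := funext fun t => (hw t).symm
    rw [this]
    exact continuous_snd.comp (continuous_subtype_val.comp (S.isCovering.continuous.comp hσ))
  have hw0 : ∀ t, w t ≠ 0 := by
    intro t h0
    have h := hwp t
    rw [h0, zero_pow k.succ_ne_zero, eq_comm, mul_eq_zero, or_iff_right (e.z_loop_ne_zero hr t)] at h
    have h2 := eq_zero_of_pow_eq_zero h
    have h3 := e.z_loop_ne hlam hr hr1 t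
    rw [div_eq_zero_iff, sub_eq_zero, sub_eq_zero] at h2
    exact h2.elim h3.2 fun h => h3.1 h.symm
  -- `e.w` is an involution, so that it also expresses `η * branch` by `w`
  have hinv : ∀ y : ℂ, y ≠ 0 → e.w k lam (e.w k lam y) = y := by
    intro y hy
    cases e
    · rfl
    · simp only [End.w]
      field_simp
  have hne : ∀ y : ℂ, y ≠ 0 → e.w k lam y ≠ 0 := by
    intro y hy
    cases e
    · exact hy
    · exact inv_ne_zero (mul_ne_zero (pow_ne_zero _ hs0) hy)
  have hbc : Continuous fun t : unitInterval => branch k lam r t :=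
    (continuous_branch hlam hr hr1).comp continuous_subtype_val
  set g : unitInterval → ℂ := fun t => e.w k lam (w t) / branch k lam r t
  have hg : Continuous g := (e.continuous_w hwc hlam hw0).div hbc fun t => hb0 t
  have hg0 : ∀ t, g t ≠ 0 := fun t => div_ne_zero (hne _ (hw0 t)) (hb0 t)
  have hgw : ∀ t, e.w k lam (g t * branch k lam r t) = w t := by
    intro t
    rw [div_mul_cancel₀ _ (hb0 t), hinv _ (hw0 t)]
  have hgp : ∀ t, g t ^ (k + 1) = (-1) ^ k := by
    intro t
    rw [← e.w_branch_pow_iff hlam hr hr1 t (hg0 t), hgw]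
    exact hwp t
  refine ⟨g 0, hg0 0, fun t => ?_⟩
  rw [hw t, ← hgw t, eq_of_pow_eq k.succ_pos hg hgp t 0]

theorem exists_isLiftedCircle (hlam : 1 < lam) (S : Face.{u} k lam c) (e : End) :
    ∃ σ, S.IsLiftedCircle e σ := by
  have hl : 0 < lam⁻¹ := inv_pos.2 (by linarith)
  obtain ⟨r, hr, hr1⟩ : ∃ r : ℝ, 0 < r ∧ r ^ (k + 1) < lam⁻¹ := by
    refine ⟨lam⁻¹ / 2, by positivity, ?_⟩
    have : lam⁻¹ < 1 := inv_lt_one_of_one_lt₀ hlam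
    calc (lam⁻¹ / 2) ^ (k + 1) ≤ lam⁻¹ / 2 :=
          pow_le_of_le_one (by positivity) (by linarith) k.succ_ne_zero
      _ < lam⁻¹ := by linarith
  obtain ⟨η, hη⟩ := IsAlgClosed.exists_pow_nat_eq ((-1 : ℂ) ^ k) k.succ_pos
  have hη0 : η ≠ 0 := by
    rintro rfl
    rw [zero_pow k.succ_ne_zero] at hη
    exact pow_ne_zero k (by norm_num) hη.symm
  have hz0 := e.z_loop_ne_zero (k := k) hr
  have hmem : ∀ t : ℝ, (((e.z k (loop 1 r t) : ℂ) : OnePoint ℂ),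
      ((e.w k lam (η * branch k lam r t) : ℂ) : OnePoint ℂ)) ∈ curve k lam := by
    intro t
    refine ⟨Or.inl ⟨_, _, rfl, (e.z_loop_ne hlam hr hr1 t).1,
      (e.w_branch_pow_iff hlam hr hr1 t hη0).2 hη⟩, ?_⟩
    rintro (h | h)
    · exact hz0 t (OnePoint.coe_injective (congrArg Prod.fst h))
    · exact OnePoint.coe_ne_infty _ (congrArg Prod.fst (Set.mem_singleton_iff.1 h))
  have hzc : Continuous fun t : ℝ => e.z k (loop 1 r t) := by
    cases e
    · exact (continuous_loop 1 r).pow _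
    · exact ((continuous_loop 1 r).pow _).inv₀ fun t h => hz0 t (inv_eq_zero.2 h)
  have hwc : Continuous fun t : ℝ => e.w k lam (η * branch k lam r t) :=
    e.continuous_w (continuous_const.mul (continuous_branch hlam hr hr1)) hlam
      fun t => mul_ne_zero hη0 (branch_ne_zero k lam hr t)
  let γ : C(unitInterval, curve k lam) :=
    ⟨fun t => ⟨_, hmem t⟩, Continuous.subtype_mk (((OnePoint.continuous_coe.comp hzc).prodMk
      (OnePoint.continuous_coe.comp hwc)).comp continuous_subtype_val) _⟩
  obtain ⟨x, hx⟩ := S.surjective (γ 0)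
  obtain ⟨Γ, hΓ, -⟩ := S.isCovering.exists_path_lifts γ x hx.symm
  refine ⟨Γ, Γ.continuous, r, hr, hr1, fun t => ?_⟩
  have := congrFun hΓ t
  simp only [Function.comp_apply] at this
  rw [this, ← loop_one_eq]
  rfl

theorem exists_isMonodromy (hlam : 1 < lam) (S : Face.{u} k lam c) (e : End) :
    ∃ ρ, S.IsMonodromy e ρ := by
  obtain ⟨σ, hσ⟩ := S.exists_isLiftedCircle hlam e
  exact ⟨(S.F (σ 0))⁻¹ * S.F (σ 1), σ, hσ, by simp⟩

end Face

/-! ### Monodromy matrices of a face -/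

/-- The permutation of the rows that turns a solution at the end `e` into one at `(0, 0)`: the
involution of the curve goes along with the exchange of the two rows. -/
def End.flip : End → Fin 2 → Fin 2
  | .zero, i => i
  | .infinity, i => 1 - i

section

variable {k : ℕ} {lam c : ℝ}

theorem hasDerivAt_z_loop (e : End) {r : ℝ} (hr : 0 < r) (t : ℝ) :
    HasDerivAt (fun t => e.z k (loop 1 r t))
      ((match e with | .zero => 1 | .infinity => -1) * (2 * Real.pi * (k + 1 : ℕ) * Complex.I) *
        e.z k (loop 1 r t)) t := by
  have h0 := e.z_loop_ne_zero (k := k) hr t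
  have hd := hasDerivAt_loop (k + 1) (r ^ (k + 1)) t
  cases e
  · simp only [End.z, loop_pow, mul_one, one_mul]
    exact hd
  · simp only [End.z, loop_pow, mul_one] at h0 ⊢
    have h1 : loop (k + 1) (r ^ (k + 1)) t ≠ 0 := fun h => h0 (inv_eq_zero.2 h)
    refine (hd.inv h1).congr_deriv ?_
    field_simp

/-- Along the circle at the end `e`, where `z' = ± K z`, the equation for the rows
`e.flip 0`, `e.flip 1` of a solution is the same at both ends. -/
theorem connectionMatrix_mul_apply (hlam : 1 < lam) (e : End) {z b : ℂ} (hz : z ≠ 0) (hb : b ≠ 0)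
    (K : ℂ) (Φ : Matrix (Fin 2) (Fin 2) ℂ) (j : Fin 2) :
    (connectionMatrix k lam c z (e.w k lam b) * Φ) (e.flip 0) j *
        ((match e with | .zero => 1 | .infinity => -1) * K * z) =
      K * c * scale k lam * Φ (e.flip 0) j + -(K * c * scale k lam ^ 2 * b) * Φ (e.flip 1) j ∧
    (connectionMatrix k lam c z (e.w k lam b) * Φ) (e.flip 1) j *
        ((match e with | .zero => 1 | .infinity => -1) * K * z) =
      K * c / b * Φ (e.flip 0) j - K * c * scale k lam * Φ (e.flip 1) j := by
  have hs0 : (scale k lam : ℂ) ≠ 0 := by exact_mod_cast (scale_pos k hlam).ne'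
  cases e <;> constructor <;>
  simp [connectionMatrix, gaussMap, End.w, End.flip, Matrix.mul_apply, Fin.sum_univ_two] <;>
  field_simp <;> ring

end

namespace Face

variable {k : ℕ} {lam c : ℝ}

theorem hasDerivWithinAt_comp (S : Face.{u} k lam c) {σ : unitInterval → S.X} (hσ : Continuous σ)
    {z : ℝ → ℂ} {z' w : ℂ} {t : ℝ} (ht : t ∈ Set.Icc (0 : ℝ) 1)
    (hz : ∀ s : unitInterval, (S.π (σ s)).1.1 = ((z s : ℂ) : OnePoint ℂ))
    (hw : (S.π (σ ⟨t, ht⟩)).1.2 = (w : OnePoint ℂ)) (hzl : z t ≠ (lam : ℂ)⁻¹)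
    (hd : HasDerivAt z z' t) (i j : Fin 2) :
    HasDerivWithinAt (fun s => (S.F (σ (Set.projIcc 0 1 zero_le_one s))).1 i j)
      ((connectionMatrix k lam c (z t) w * (S.F (σ (Set.projIcc 0 1 zero_le_one t))).1) i j * z')
      (Set.Icc 0 1) t := by
  have hp : Set.projIcc (0 : ℝ) 1 zero_le_one t = ⟨t, ht⟩ := Set.projIcc_of_mem _ ht
  obtain ⟨Φ, h1, h2⟩ := S.isSolution.equation (σ ⟨t, ht⟩) (z t) w
    (Prod.ext (hz ⟨t, ht⟩) hw) hzl
  have h3 := h2 i j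
  have hc : Continuous fun s : ℝ => σ (Set.projIcc 0 1 zero_le_one s) :=
    hσ.comp continuous_projIcc
  have h4 := hc.continuousAt (x := t)
  rw [ContinuousAt, hp] at h4
  have h5 : ∀ᶠ s in 𝓝[Set.Icc 0 1] t,
      (S.F (σ (Set.projIcc 0 1 zero_le_one s))).1 i j = Φ (z s) i j := by
    filter_upwards [nhdsWithin_le_nhds (h4.eventually h1), self_mem_nhdsWithin] with s hs hsI
    rw [hs (z s)]
    rw [hz, Set.projIcc_of_mem _ hsI]
  have e : (S.F (σ (Set.projIcc 0 1 zero_le_one t))).1 = Φ (z t) := by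
    rw [hp]
    exact h1.self_of_nhds (z t) (hz ⟨t, ht⟩)
  rw [e]
  refine HasDerivWithinAt.congr_of_eventuallyEq ?_ h5 (congrFun (congrFun e i) j)
  exact (HasDerivAt.comp t h3 hd).hasDerivWithinAt

/-- A monodromy matrix of a face lies in `SU(1,1)`, since the circle is closed and the surface is
defined on `M`; and it is similar to the diagonal matrix given by the Frobenius exponents. -/
theorem IsMonodromy.mem_SU11_and_diagonal (hlam : 1 < lam) (hc : c ≠ 0) {S : Face.{u} k lam c}
    {e : End} {ρ : Matrix.SpecialLinearGroup (Fin 2) ℂ} (hρ : S.IsMonodromy e ρ) {m m' : ℂ}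
    (hmm : m ≠ m')
    (hm : m ^ 2 + logDerivCoeff k lam 0 * (m + scale k lam * c) = 0)
    (hn : ∀ n : ℕ, 1 ≤ n → (n + 2 * m + logDerivCoeff k lam 0 : ℂ) ≠ 0)
    (hm' : m' ^ 2 + logDerivCoeff k lam 0 * (m' + scale k lam * c) = 0)
    (hn' : ∀ n : ℕ, 1 ≤ n → (n + 2 * m' + logDerivCoeff k lam 0 : ℂ) ≠ 0) :
    ρ ∈ SU11 ∧ ∃ L : Matrix (Fin 2) (Fin 2) ℂ, L.det ≠ 0 ∧
      L * ρ.1 = Matrix.diagonal ![Complex.exp (-(2 * Real.pi * (k + 1 : ℕ) * Complex.I * m)),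
        Complex.exp (-(2 * Real.pi * (k + 1 : ℕ) * Complex.I * m'))] * L := by
  obtain ⟨σ, ⟨hσ, r, hr, hr1, hz⟩, hF⟩ := hρ
  replace hz : ∀ t : unitInterval,
      (S.π (σ t)).1.1 = ((e.z k (loop 1 r t) : ℂ) : OnePoint ℂ) := by
    intro t
    rw [hz t, loop_one_eq]
  obtain ⟨η, hη, hw⟩ := IsLiftedCircle.exists_branch hlam hσ hr hr1 hz
  constructor
  · have hπ : S.π (σ 1) = S.π (σ 0) := by
      refine Subtype.ext (Prod.ext ?_ ?_)
      · rw [hz, hz]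
        simp only [Set.Icc.coe_one, Set.Icc.coe_zero, loop_one, loop_zero]
      · rw [hw, hw]
        simp only [Set.Icc.coe_one, Set.Icc.coe_zero, branch_one]
    have h1 := S.f_eq (σ 1)
    rw [hπ, S.f_eq (σ 0), hF] at h1
    have h2 : hermitianOrbit (S.F (σ 0) * ρ) =
        (S.F (σ 0)).1 * hermitianOrbit ρ * (S.F (σ 0)).1ᴴ := by
      simp only [hermitianOrbit, Matrix.SpecialLinearGroup.coe_mul, Matrix.conjTranspose_mul,
        Matrix.mul_assoc]
    rw [h2, hermitianOrbit] at h1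
    have hdet : IsUnit (S.F (σ 0)).1 := by
      rw [Matrix.isUnit_iff_isUnit_det, (S.F (σ 0)).2]
      exact isUnit_one
    have hdet' : IsUnit (S.F (σ 0)).1ᴴ := hdet.star
    exact (hdet.mul_left_cancel (hdet'.mul_right_cancel h1)).symm
  · have hbr := branch_ne_zero k lam hr
    set Φ : ℝ → Matrix (Fin 2) (Fin 2) ℂ := fun t => Matrix.of fun i j =>
      (S.F (σ (Set.projIcc 0 1 zero_le_one t))).1 (e.flip i) j with hΦ
    have hd : ∀ t (ht : t ∈ Set.Icc (0 : ℝ) 1) (i j : Fin 2), _ := fun t ht =>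
      hasDerivWithinAt_comp S hσ ht hz (hw ⟨t, ht⟩) (e.z_loop_ne hlam hr hr1 t).2
        (hasDerivAt_z_loop e hr t)
    have hA := fun (t : ℝ) => connectionMatrix_mul_apply (k := k) (c := c) hlam e
      (e.z_loop_ne_zero (k := k) hr t) (mul_ne_zero hη (hbr t))
      (2 * Real.pi * (k + 1 : ℕ) * Complex.I)
    refine exists_monodromy_diagonal (Φ := Φ) hlam hc hr hr1 hη hmm hm hn hm' hn' ?_ ?_ ?_ ?_
    · exact fun j t ht => (hd t ht (e.flip 0) j).congr_deriv (hA t _ j).1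
    · exact fun j t ht => (hd t ht (e.flip 1) j).congr_deriv (hA t _ j).2
    · have hdet := (S.F (σ (Set.projIcc 0 1 zero_le_one 0))).2
      rw [Matrix.det_fin_two] at hdet
      rw [Matrix.det_fin_two]
      cases e
      · simp only [hΦ, End.flip, Matrix.of_apply]
        rw [hdet]
        exact one_ne_zero
      · intro h0
        simp only [hΦ, End.flip, Matrix.of_apply, sub_zero, sub_self] at h0
        apply one_ne_zero (α := ℂ)
        rw [← hdet]
        linear_combination -h0
    · have h0 : Set.projIcc (0 : ℝ) 1 zero_le_one 0 = 0 := Set.projIcc_left _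
      have h1 : Set.projIcc (0 : ℝ) 1 zero_le_one 1 = 1 := Set.projIcc_right _
      ext i j
      simp only [hΦ, h0, h1, hF, Matrix.SpecialLinearGroup.coe_mul, Matrix.of_apply,
        Matrix.mul_apply]

end Face

/-! ### The types of the ends -/

theorem trace_eq_of_diagonal {L ρ : Matrix (Fin 2) (Fin 2) ℂ} {x y : ℂ} (hL : L.det ≠ 0)
    (h : L * ρ = Matrix.diagonal ![x, y] * L) : ρ 0 0 + ρ 1 1 = x + y := by
  have hu : IsUnit L.det := isUnit_iff_ne_zero.2 hL
  have h1 : ρ = L⁻¹ * (Matrix.diagonal ![x, y] * L) := by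
    rw [← h, Matrix.nonsing_inv_mul_cancel_left _ _ hu]
  rw [← Matrix.trace_fin_two, h1, Matrix.trace_mul_comm, Matrix.mul_nonsing_inv_cancel_right _ _ hu,
    Matrix.trace_fin_two]
  simp

theorem eq_smul_one_of_diagonal {L ρ : Matrix (Fin 2) (Fin 2) ℂ} {x : ℂ} (hL : L.det ≠ 0)
    (h : L * ρ = Matrix.diagonal ![x, x] * L) : ρ = x • 1 := by
  have hu : IsUnit L.det := isUnit_iff_ne_zero.2 hL
  have h2 : Matrix.diagonal ![x, x] = x • (1 : Matrix (Fin 2) (Fin 2) ℂ) := by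
    ext i j
    fin_cases i <;> fin_cases j <;> simp
  rw [← Matrix.nonsing_inv_mul_cancel_left L ρ hu, h, h2, Matrix.smul_mul, Matrix.one_mul,
    Matrix.mul_smul, Matrix.nonsing_inv_mul _ hu]

namespace Face

variable {k : ℕ} {lam c : ℝ}

/-- The Frobenius exponents are `(-1 ± δ) / (2 (k + 1))`, where `δ ^ 2` is the discriminant. They
do not differ by an integer as long as `δ` is not an integer multiple of `k + 1`. -/
theorem IsMonodromy.mem_SU11_and_diagonal_of_sq (hlam : 1 < lam) (hc : c ≠ 0)
    {S : Face.{u} k lam c} {e : End} {ρ : Matrix.SpecialLinearGroup (Fin 2) ℂ}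
    (hρ : S.IsMonodromy e ρ) {δ : ℂ} (hδ : δ ^ 2 = (disc k lam c : ℂ)) (hδ0 : δ ≠ 0)
    (hne : ∀ n : ℕ, 1 ≤ n → disc k lam c ≠ ((n : ℝ) * ((k : ℝ) + 1)) ^ 2) :
    ρ ∈ SU11 ∧ ∃ L : Matrix (Fin 2) (Fin 2) ℂ, L.det ≠ 0 ∧
      L * ρ.1 = Matrix.diagonal ![Complex.exp (Real.pi * (1 - δ) * Complex.I),
        Complex.exp (Real.pi * (1 + δ) * Complex.I)] * L := by
  have hk : (k + 1 : ℂ) ≠ 0 := by exact_mod_cast k.succ_ne_zero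
  have hroot : ∀ ε : ℂ, ε ^ 2 = (disc k lam c : ℂ) →
      ((-1 + ε) / (2 * (k + 1))) ^ 2 + logDerivCoeff k lam 0 *
        ((-1 + ε) / (2 * (k + 1)) + scale k lam * c) = 0 := by
    intro ε hε
    have hd : (disc k lam c : ℂ) = 1 - 4 * c * (k + 1) * scale k lam := by
      rw [disc]; push_cast; rfl
    rw [hd] at hε
    rw [logDerivCoeff_zero]
    field_simp
    linear_combination hε
  have hnon : ∀ ε : ℂ, ε ^ 2 = (disc k lam c : ℂ) → ∀ n : ℕ, 1 ≤ n →
      (n + 2 * ((-1 + ε) / (2 * (k + 1))) + logDerivCoeff k lam 0 : ℂ) ≠ 0 := by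
    intro ε hε n hn h0
    rw [logDerivCoeff_zero] at h0
    field_simp at h0
    have h1 : ε = -(n * (k + 1)) := by linear_combination h0
    apply hne n hn
    rw [h1, neg_sq] at hε
    exact_mod_cast hε.symm
  have hδ' : (-δ) ^ 2 = (disc k lam c : ℂ) := by rw [neg_sq, hδ]
  have hmm : (-1 + δ) / (2 * (k + 1) : ℂ) ≠ (-1 + -δ) / (2 * (k + 1)) := by
    intro h
    rw [div_left_inj' (mul_ne_zero two_ne_zero hk)] at h
    apply hδ0
    linear_combination h / 2
  have h := hρ.mem_SU11_and_diagonal hlam hc hmm (hroot δ hδ) (hnon δ hδ) (hroot (-δ) hδ')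
    (hnon (-δ) hδ')
  have e1 : ∀ ε : ℂ, -(2 * Real.pi * (k + 1 : ℕ) * Complex.I * ((-1 + ε) / (2 * (k + 1)))) =
      Real.pi * (1 - ε) * Complex.I := by
    intro ε
    push_cast
    field_simp
    ring
  rw [e1, e1, sub_neg_eq_add] at h
  exact h

theorem ellipticEnd (hlam : 1 < lam) (hc : c ≠ 0) (S : Face.{u} k lam c)
    (hpos : 0 < disc k lam c)
    (hne : ∀ n : ℕ, 1 ≤ n → disc k lam c ≠ ((n : ℝ) * ((k : ℝ) + 1)) ^ 2) (e : End) :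
    S.EllipticEnd e := by
  refine ⟨S.exists_isMonodromy hlam e, fun ρ hρ => ?_⟩
  set d := Real.sqrt (disc k lam c)
  have hd0 : (d : ℂ) ≠ 0 := by exact_mod_cast (Real.sqrt_pos.2 hpos).ne'
  have hd : (d : ℂ) ^ 2 = (disc k lam c : ℂ) := by exact_mod_cast Real.sq_sqrt hpos.le
  obtain ⟨hSU, L, hL, h⟩ := hρ.mem_SU11_and_diagonal_of_sq hlam hc hd hd0 hne
  -- the eigenvalues are `exp (± i θ)`
  set θ : ℝ := Real.pi * (1 + d) with hθ
  have e1 : Complex.exp (Real.pi * (1 + d) * Complex.I) = Complex.cos θ + Complex.sin θ *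
      Complex.I := by
    rw [← Complex.exp_mul_I, hθ]
    push_cast
    rfl
  have e2 : Complex.exp (Real.pi * (1 - d) * Complex.I) = Complex.cos θ - Complex.sin θ *
      Complex.I := by
    have h1 : (Real.pi * (1 - d) * Complex.I : ℂ) = (-θ : ℂ) * Complex.I +
        2 * Real.pi * Complex.I := by
      rw [hθ]
      push_cast
      ring
    rw [h1, Complex.exp_periodic, Complex.exp_mul_I, Complex.cos_neg, Complex.sin_neg]
    ring
  rw [e1, e2] at h
  by_cases hs : Real.sin θ = 0
  · have h2 := Real.sin_eq_zero_iff_cos_eq.1 hs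
    have hs' : Complex.sin θ = 0 := by exact_mod_cast congrArg Complex.ofReal hs
    rw [hs', zero_mul, sub_zero, add_zero] at h
    have h1 := eq_smul_one_of_diagonal hL h
    rcases h2 with h2 | h2
    · have : ρ = 1 := Subtype.ext (by rw [h1, ← Complex.ofReal_cos, h2]; simp)
      rw [this]
      exact isElliptic_one
    · have : ρ = -1 := Subtype.ext (by rw [h1, ← Complex.ofReal_cos, h2]; simp)
      rw [this]
      exact isElliptic_neg_one
  · refine isElliptic_of_trace hSU hs ?_
    rw [trace_eq_of_diagonal hL h, Complex.ofReal_cos]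
    ring

theorem hyperbolicEnd (hlam : 1 < lam) (hc : c ≠ 0) (S : Face.{u} k lam c)
    (hneg : disc k lam c < 0) (e : End) : S.HyperbolicEnd e := by
  refine ⟨S.exists_isMonodromy hlam e, fun ρ hρ => ?_⟩
  set d := Real.sqrt (-disc k lam c)
  have hd0 : 0 < d := Real.sqrt_pos.2 (by linarith)
  have hd0' : (d * Complex.I : ℂ) ≠ 0 :=
    mul_ne_zero (by exact_mod_cast hd0.ne') Complex.I_ne_zero
  have hd : (d * Complex.I : ℂ) ^ 2 = (disc k lam c : ℂ) := by
    have h1 : (d : ℂ) ^ 2 = -(disc k lam c : ℂ) := by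
      exact_mod_cast Real.sq_sqrt (by linarith : 0 ≤ -disc k lam c)
    rw [mul_pow, h1, Complex.I_sq]
    ring
  obtain ⟨hSU, L, hL, h⟩ := hρ.mem_SU11_and_diagonal_of_sq hlam hc hd hd0'
    fun n _ h => (hneg.trans_le (sq_nonneg _)).ne h
  -- the eigenvalues are `- exp (± π d)`
  have e1 : ∀ ε : ℂ, Complex.exp (Real.pi * (1 + ε * (d * Complex.I)) * Complex.I) =
      -Complex.exp (-(ε * (Real.pi * d))) := by
    intro ε
    have h1 : (Real.pi * (1 + ε * (d * Complex.I)) * Complex.I : ℂ) = -(ε * (Real.pi * d)) +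
        Real.pi * Complex.I := by
      linear_combination (ε * Real.pi * d) * Complex.I_sq
    rw [h1, Complex.exp_add, Complex.exp_pi_mul_I]
    ring
  refine isHyperbolic_of_trace hSU (mul_pos Real.pi_pos hd0) (Or.inr rfl) ?_
  have e2 := e1 1
  have e3 := e1 (-1)
  rw [one_mul, one_mul] at e2
  rw [neg_one_mul, neg_one_mul, neg_neg, ← sub_eq_add_neg] at e3
  rw [trace_eq_of_diagonal hL h, e2, e3, Complex.ofReal_cosh, Complex.cosh]
  push_cast
  ring

end Face

theorem scale_two_lt (k : ℕ) : scale k 2 < 2 := by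
  have h : (k : ℝ) / (k + 1) < 1 := by
    rw [div_lt_one (by positivity)]
    linarith
  simpa [scale] using Real.rpow_lt_rpow_of_exponent_lt one_lt_two h

theorem one_le_scale (k : ℕ) {lam : ℝ} (hlam : 1 < lam) : 1 ≤ scale k lam :=
  Real.one_le_rpow hlam.le (by positivity)

/-- A real number strictly between the squares of two consecutive multiples of `k + 1` is not the
square of a multiple. -/
theorem ne_sq_of_between {k l n : ℕ} {D : ℝ} (h1 : ((l : ℝ) * (k + 1)) ^ 2 < D)
    (h2 : D < (((l : ℝ) + 1) * (k + 1)) ^ 2) : D ≠ ((n : ℝ) * (k + 1)) ^ 2 := by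
  rintro rfl
  have hk : (0 : ℝ) < k + 1 := by positivity
  have h3 := lt_of_pow_lt_pow_left₀ 2 (by positivity) h1
  have h4 := lt_of_pow_lt_pow_left₀ 2 (by positivity) h2
  have h5 : (l : ℝ) < n := lt_of_mul_lt_mul_right h3 hk.le
  have h6 : (n : ℝ) < (l : ℝ) + 1 := lt_of_mul_lt_mul_right h4 hk.le
  have h7 : l < n := by exact_mod_cast h5
  have h8 : n < l + 1 := by exact_mod_cast h6
  omega

theorem disc_middleColumn (i : Fin 20) {c : ℝ} (hc : |c - middleColumn i| ≤ 1 / 10 ^ 4) :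
    c < 0 ∧ 0 < disc (i.val + 1) 2 c ∧
      ∀ n : ℕ, 1 ≤ n → disc (i.val + 1) 2 c ≠ ((n : ℝ) * (((i.val + 1 : ℕ) : ℝ) + 1)) ^ 2 := by
  obtain ⟨hc1, hc2⟩ := abs_le.1 hc
  have hs1 := one_le_scale (i.val + 1) one_lt_two
  have hs2 := scale_two_lt (i.val + 1)
  have hcol : middleColumn i < -0.44 := by
    fin_cases i <;> norm_num [middleColumn]
  have hneg : c < -0.4 := by norm_num at hc2 hcol ⊢; linarith
  have hprod : 0 < -c * scale (i.val + 1) 2 := mul_pos (by linarith) (by linarith)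
  refine ⟨by linarith, ?_, fun n hn => ?_⟩
  · rw [disc]
    have : (0 : ℝ) < ((i.val + 1 : ℕ) : ℝ) + 1 := by positivity
    nlinarith [mul_pos hprod this]
  have hpow := scale_pow (i.val + 1) one_lt_two
  rcases Nat.lt_or_ge 2 i.val with hi | hi
  · -- here `0 < disc < (k + 1) ^ 2`
    have hcol' : -0.472 < middleColumn i := by
      revert hi
      fin_cases i <;> norm_num [middleColumn]
    have hk : (5 : ℝ) ≤ ((i.val + 1 : ℕ) : ℝ) + 1 := by
      have : (3 : ℝ) ≤ i.val := by exact_mod_cast hi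
      push_cast
      linarith
    refine ne_sq_of_between (l := 0) ?_ ?_ <;> rw [disc]
    · have : (0 : ℝ) < ((i.val + 1 : ℕ) : ℝ) + 1 := by positivity
      norm_num only [Nat.cast_zero, zero_mul]
      nlinarith [mul_pos hprod this]
    · have hcs : -c * scale (i.val + 1) 2 < 0.4721 * 2 := by
        norm_num at hc1 hcol' ⊢
        nlinarith
      set x : ℝ := ((i.val + 1 : ℕ) : ℝ) + 1
      norm_num only [Nat.cast_zero, zero_add, one_mul] at hcs ⊢
      nlinarith
  · obtain ⟨i, hi20⟩ := i
    simp only at hi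
    interval_cases i
    · -- `4 < disc < 16`
      norm_num [middleColumn] at hc1 hc2 hs1 hs2 hpow hprod
      have hs : 1.4 < scale 1 2 := by nlinarith
      refine ne_sq_of_between (l := 1) ?_ ?_ <;> rw [disc] <;> norm_num at hs ⊢ <;> nlinarith
    · -- `9 < disc < 36`
      norm_num [middleColumn] at hc1 hc2 hs1 hs2 hpow hprod
      have hs : 1.58 < scale 2 2 := lt_of_pow_lt_pow_left₀ 3 (by linarith) (by rw [hpow]; norm_num)
      refine ne_sq_of_between (l := 1) ?_ ?_ <;> rw [disc] <;> norm_num at hs ⊢ <;> nlinarith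
    · -- `0 < disc < 16`
      norm_num [middleColumn] at hc1 hc2 hs1 hs2 hpow hprod
      have hs : scale 3 2 < 1.7 := lt_of_pow_lt_pow_left₀ 4 (by norm_num) (by rw [hpow]; norm_num)
      refine ne_sq_of_between (l := 0) ?_ ?_ <;> rw [disc] <;> norm_num at hs ⊢ <;> nlinarith

theorem disc_rightColumn (i : Fin 20) {c : ℝ} (hc : |c - rightColumn i| ≤ 1 / 10 ^ 4) :
    0 < c ∧ disc (i.val + 1) 2 c < 0 := by
  obtain ⟨hc1, hc2⟩ := abs_le.1 hc
  have hs1 := one_le_scale (i.val + 1) one_lt_two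
  have hcol : 0.34 < rightColumn i := by
    fin_cases i <;> norm_num [rightColumn]
  have hpos : 0.3 < c := by norm_num at hc1 hcol ⊢; linarith
  refine ⟨by linarith, ?_⟩
  have hk : (2 : ℝ) ≤ ((i.val + 1 : ℕ) : ℝ) + 1 := by
    push_cast
    linarith [i.val.cast_nonneg (α := ℝ)]
  rw [disc]
  have h1 : 0.3 ≤ c * scale (i.val + 1) 2 := by nlinarith
  nlinarith

end CMCFace

theorem mainTheorem2 :
    -- the type of the ends is given by the sign of `disc`
    (∀ (k : ℕ) (lam c : ℝ), 1 ≤ k → 1 < lam → c ≠ 0 → ∀ S : CMCFace.Face.{u} k lam c,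
      (0 < CMCFace.disc k lam c →
        (∀ n : ℕ, 1 ≤ n → CMCFace.disc k lam c ≠ ((n : ℝ) * ((k : ℝ) + 1)) ^ 2) →
        ∀ e : CMCFace.End, S.EllipticEnd e) ∧
      (CMCFace.disc k lam c < 0 → ∀ e : CMCFace.End, S.HyperbolicEnd e)) ∧
    -- the middle column, with `c` equal to the tabulated value up to an error of `10 ^ (-4)`
    (∀ (i : Fin 20) (c : ℝ), |c - CMCFace.middleColumn i| ≤ 1 / 10 ^ 4 →
      0 < CMCFace.disc (i.val + 1) 2 c ∧
      ∀ (S : CMCFace.Face.{u} (i.val + 1) 2 c) (e : CMCFace.End), S.EllipticEnd e) ∧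
    -- the right hand column, likewise
    (∀ (i : Fin 20) (c : ℝ), |c - CMCFace.rightColumn i| ≤ 1 / 10 ^ 4 →
      CMCFace.disc (i.val + 1) 2 c < 0 ∧
      ∀ (S : CMCFace.Face.{u} (i.val + 1) 2 c) (e : CMCFace.End), S.HyperbolicEnd e) := by
  refine ⟨fun k lam c _ hlam hc S => ⟨fun hpos hne e => S.ellipticEnd hlam hc hpos hne e,
    fun hneg e => S.hyperbolicEnd hlam hc hneg e⟩, fun i c hc => ?_, fun i c hc => ?_⟩
  · obtain ⟨h0, hpos, hne⟩ := CMCFace.disc_middleColumn i hc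
    exact ⟨hpos, fun S e => S.ellipticEnd one_lt_two h0.ne hpos hne e⟩
  · obtain ⟨h0, hneg⟩ := CMCFace.disc_rightColumn i hc
    exact ⟨hneg, fun S e => S.hyperbolicEnd one_lt_two h0.ne' hneg e⟩
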